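/- Fix a constant $\omega > 0$. For $n \ge 1$ consider worlds $(Q,T,F)$ with $Q\in\{-1,1\}$ and $T,F\in\{0,1\}^n$, and the distribution $\pi(Q,T,F) = \frac1Z \exp(\epsilon(Q,T,F))$ with energy \[ \epsilon(Q,T,F) = w\,Q\,g(T) - w\,Q\,g(F) + \sum_{i=1}^n w_{T_i} T_i + \sum_{i=1}^n w_{F_i} F_i , \] where $g(x)=\sum_i x_i$ (the voting model with linear semantics), $g(x)=\max_i x_i$ (logical semantics), or $g(x)=\log\bigl(1+\sum_i x_i\bigr)$ (ratio semantics), and where the weights satisfy $w>0$ and $\{w, w_{T_1},\dots,w_{T_n}, w_{F_1},\dots,w_{F_n}\}\subset[-\omega,\omega]$. Gibbs sampling on this model is the Markov chain that at each step chooses one of the $2n+1$ variables uniformly at random and resamples it from its conditional distribution under $\pi$ given all the other variables. Its mixing time $t_{\mathrm{mix}}$ is the least $t$ such that, for every initial world, the distribution $\mu_t$ of the chain after $t$ steps satisfies $\max_A |\mu_t(A)-\pi(A)|\le \frac14$, the maximum being over all sets $A$ of worlds. For each of the three semantics and each $n \ge 1$, among all models with weights as above there is a largest, finite mixing time $t_{\max}(n)$,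 and as $n\to\infty$ with $\omega$ fixed: 1. for linear semantics, $t_{\max}(n) = 2^{\Theta(n)}$, that is, there are constants $a,b>0$ (depending only on $\omega$) with $2^{an}\le t_{\max}(n)\le 2^{bn}$ for all sufficiently large $n$; 2. for logical semantics, $t_{\max}(n)=\Theta(n\log n)$; 3. for ratio semantics, $t_{\max}(n)=\Theta(n\log n)$. -/

import Mathlib

open Filter

noncomputable section

/-! ## Factor graphs, Gibbs sampling and mixing times

A world assigns to each variable in a finite set `V` a value in a finite set `S`; a model is given
by its energy function on worlds. -/

/-- The distribution `π(I) = exp (ε I) / Z` determined by the energy function `ε`. -/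
def gibbsMeasure {V S : Type} [Fintype V] [DecidableEq V] [Fintype S]
    (ε : (V → S) → ℝ) (I : V → S) : ℝ :=
  Real.exp (ε I) / ∑ J : V → S, Real.exp (ε J)

/-- The conditional probability under `gibbsMeasure ε` that the variable `v` has the value `s`,
given that all the other variables have the values that they have in `I`. -/
def conditionalProb {V S : Type} [DecidableEq V] [Fintype S]
    (ε : (V → S) → ℝ) (I : V → S) (v : V) (s : S) : ℝ :=
  Real.exp (ε (Function.update I v s)) / ∑ r : S, Real.exp (ε (Function.update I v r))

/-- The transition matrix of (single-site, random-scan) Gibbs sampling: from the world `I`, choose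
a variable `v` uniformly at random and resample its value from its conditional distribution given
the values of the other variables. Row `I` is the distribution of the next world. -/
def gibbsMatrix {V S : Type} [Fintype V] [DecidableEq V] [Fintype S] [DecidableEq S]
    (ε : (V → S) → ℝ) : Matrix (V → S) (V → S) ℝ :=
  fun I J => ∑ v : V, ∑ s : S,
    if J = Function.update I v s then (Fintype.card V : ℝ)⁻¹ * conditionalProb ε I v s else 0

/-- The mixing time of the Markov chain with transition matrix `P` and stationary distribution
`π`: the first time `t` at which, for every initial state `x`, the distribution `μ_t = P ^ t x` of
the chain satisfies `|μ_t(A) - π(A)| ≤ 1 / 4` for every event `A`. It is `⊤` if there is none. -/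
def mixingTime {Ω : Type} [Fintype Ω] [DecidableEq Ω] (P : Matrix Ω Ω ℝ) (π : Ω → ℝ) : ℕ∞ :=
  ⨅ t ∈ {t : ℕ | ∀ x : Ω, ∀ A : Finset Ω,
    |(∑ y ∈ A, (P ^ t) x y) - ∑ y ∈ A, π y| ≤ 1 / 4}, (t : ℕ∞)

/-- The mixing time of Gibbs sampling on the model with energy function `ε`. -/
def gibbsMixingTime {V S : Type} [Fintype V] [DecidableEq V] [Fintype S] [DecidableEq S]
    (ε : (V → S) → ℝ) : ℕ∞ :=
  mixingTime (gibbsMatrix ε) (gibbsMeasure ε)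

/-! ## The voting model -/

/-- The `2 n + 1` variables of the voting model: the query variable `Q`, the true-voters `T i` and
the false-voters `F i`. -/
abbrev VotingVar (n : ℕ) : Type := Unit ⊕ Fin n ⊕ Fin n

namespace VotingVar

/-- The query variable. -/
abbrev Q {n : ℕ} : VotingVar n := Sum.inl ()

/-- The true-voter with index `i`. -/
abbrev T {n : ℕ} (i : Fin n) : VotingVar n := Sum.inr (Sum.inl i)

/-- The false-voter with index `i`. -/
abbrev F {n : ℕ} (i : Fin n) : VotingVar n := Sum.inr (Sum.inr i)

end VotingVar

/-- A world of the voting model. Each variable has two values, encoded by `Bool`: `true` stands for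
`1`, while `false` stands for `-1` at the query variable and for `0` at the voters. -/
abbrev VotingWorld (n : ℕ) : Type := VotingVar n → Bool

/-- The value in `{-1, 1}` of the query variable. -/
def queryValue (b : Bool) : ℝ := if b then 1 else -1

/-- The value in `{0, 1}` of a voter variable. -/
def voterValue (b : Bool) : ℝ := if b then 1 else 0

/-- The three versions of the voting model. -/
inductive VotingSemantics : Type
  | linear
  | logical
  | ratio

/-- The strength of a vote: the sum, the maximum, or the logarithm of one plus the sum. -/
def VotingSemantics.strength (σ : VotingSemantics) {n : ℕ} (x : Fin n → ℝ) : ℝ :=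
  match σ with
  | .linear => ∑ i, x i
  | .logical => ⨆ i, x i
  | .ratio => Real.log (1 + ∑ i, x i)

/-- The energy function of the voting model with the semantics `σ`, the vote weight `w`, and the
prior weights `wT i`, `wF i` of the voters. -/
def votingEnergy (σ : VotingSemantics) {n : ℕ} (w : ℝ) (wT wF : Fin n → ℝ)
    (I : VotingWorld n) : ℝ :=
  w * queryValue (I VotingVar.Q) * σ.strength (fun i => voterValue (I (VotingVar.T i)))
    - w * queryValue (I VotingVar.Q) * σ.strength (fun i => voterValue (I (VotingVar.F i)))
    + ∑ i, wT i * voterValue (I (VotingVar.T i))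
    + ∑ i, wF i * voterValue (I (VotingVar.F i))

/-- The set of the mixing times of Gibbs sampling on the voting models with `n` voters on each side
and weights in `[-ω, ω]` (the vote weight `w` being positive). -/
def votingMixingTimes (σ : VotingSemantics) (ω : ℝ) (n : ℕ) : Set ℕ∞ :=
  {τ | ∃ (w : ℝ) (wT wF : Fin n → ℝ), 0 < w ∧ w ∈ Set.Icc (-ω) ω ∧
    (∀ i, wT i ∈ Set.Icc (-ω) ω) ∧ (∀ i, wF i ∈ Set.Icc (-ω) ω) ∧
    τ = gibbsMixingTime (votingEnergy σ w wT wF)}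

end

set_option linter.unusedSectionVars false

/-! ### Gibbs sampling as a Markov chain: stationarity and a criterion for mixing -/

section Markov

variable {V S : Type} [Fintype V] [DecidableEq V] [Fintype S]

/-! Four estimates carry the theorem.

Logical and ratio semantics, upper bound (`exists_votingMixingTimes_le`). Two copies of the chain
resample the same variable with maximally coupled values. A vote added to `s` others changes the
strength by at most `1 / (1 + s)`. Hence, once both sides have order `n` votes, each voter has total
influence `O(1/n)` on the rest; the query has total influence `O(1)` on the voters, which a large
constant weight at the query in the Hamming distance absorbs. Worlds with few votes spoil this, but
every resampled voter becomes 1 with probability bounded below, so the votes recover. This is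
encoded by adding to the distance the penalty `M * deficit ^ 3` of each world and side. With `M` of
order `n⁻²` the drift of the penalty beats the loss in bad worlds, its maximum is `O(n)`, and the
residual error `O(n M)` tends to 0; with a square in place of the cube, the same balance leaves an
error of constant order. A contraction by `1 - 1 / (2 (2 n + 1))` per step from an initial distance
`O(n)` gives `O(n log n)`.

Lower bound `n log n` for all semantics (`eventually_exists_le_votingMixingTime`). As `w → 0` with
zero priors, the chain tends to uniform resampling on the hypercube, where the first two moments of
the magnetization rule out early mixing; continuity transfers this to small positive `w`.

Linear semantics, lower bound (`exists_exp_le_votingMixingTime_linear`). With `w = ω` and zero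
priors, the two values of the query are separated by an exponentially narrow bottleneck.

Exponential upper bound (`exists_votingMixingTimes_le_exp`). A Doeblin minorization over `2 n + 1`
steps; it also makes the largest mixing time finite and attained. -/

theorem conditionalProb_nonneg (ε : (V → S) → ℝ) (I : V → S) (v : V) (s : S) :
    0 ≤ conditionalProb ε I v s := by
  unfold conditionalProb; positivity

theorem sum_conditionalProb [Nonempty S] (ε : (V → S) → ℝ) (I : V → S) (v : V) :
    ∑ s, conditionalProb ε I v s = 1 := by
  unfold conditionalProb
  rw [← Finset.sum_div]
  refine div_self (ne_of_gt (Finset.sum_pos (fun _ _ => Real.exp_pos _) Finset.univ_nonempty))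

variable [DecidableEq S]

theorem gibbsMatrix_nonneg (ε : (V → S) → ℝ) (I J : V → S) : 0 ≤ gibbsMatrix ε I J := by
  unfold gibbsMatrix
  refine Finset.sum_nonneg fun v _ => Finset.sum_nonneg fun s _ => ?_
  split_ifs
  · exact mul_nonneg (by positivity) (conditionalProb_nonneg ..)
  · exact le_rfl

theorem gibbsMatrix_mulVec (ε : (V → S) → ℝ) (f : (V → S) → ℝ) (I : V → S) :
    (gibbsMatrix ε).mulVec f I = (Fintype.card V : ℝ)⁻¹ *
      ∑ v, ∑ s, conditionalProb ε I v s * f (Function.update I v s) := by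
  simp only [Matrix.mulVec, dotProduct, gibbsMatrix, Finset.sum_mul, Finset.mul_sum, ite_mul,
    zero_mul]
  rw [Finset.sum_comm]
  refine Finset.sum_congr rfl fun v _ => ?_
  rw [Finset.sum_comm]
  refine Finset.sum_congr rfl fun s _ => ?_
  rw [Finset.sum_ite_eq' Finset.univ]
  simp [mul_assoc]

theorem gibbsMatrix_mulVec_one [Nonempty V] [Nonempty S] (ε : (V → S) → ℝ) :
    (gibbsMatrix ε).mulVec 1 = 1 := by
  ext I
  rw [gibbsMatrix_mulVec]
  simp [sum_conditionalProb]

theorem gibbsMeasure_nonneg (ε : (V → S) → ℝ) (I : V → S) : 0 ≤ gibbsMeasure ε I := by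
  unfold gibbsMeasure; positivity

theorem sum_gibbsMeasure [Nonempty S] (ε : (V → S) → ℝ) : ∑ I, gibbsMeasure ε I = 1 := by
  unfold gibbsMeasure
  rw [← Finset.sum_div]
  exact div_self (ne_of_gt (Finset.sum_pos (fun _ _ => Real.exp_pos _) Finset.univ_nonempty))

/-- Exchanging the value at `v` of a world with a second value. -/
def swapValue (v : V) : ((V → S) × S) ≃ ((V → S) × S) where
  toFun x := (Function.update x.1 v x.2, x.1 v)
  invFun x := (Function.update x.1 v x.2, x.1 v)
  left_inv x := by simp
  right_inv x := by simp

/-- Detailed balance: the weight `π(I)` times the conditional probability of `s` is proportional to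
the exponentials of the energies of both worlds with a common denominator, so it is invariant under
`swapValue`. -/
theorem sum_gibbsMeasure_resample [Nonempty S] (ε : (V → S) → ℝ) (f : (V → S) → ℝ) (v : V) :
    ∑ I, gibbsMeasure ε I * ∑ s, conditionalProb ε I v s * f (Function.update I v s) =
      ∑ I, gibbsMeasure ε I * f I := by
  have h1 : ∀ I, gibbsMeasure ε I * f I =
      ∑ s, gibbsMeasure ε I * conditionalProb ε I v s * f I := by
    intro I
    rw [← Finset.sum_mul, ← Finset.mul_sum, sum_conditionalProb, mul_one]
  simp only [h1, Finset.mul_sum]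
  rw [← Fintype.sum_prod_type', ← Fintype.sum_prod_type']
  rw [← Equiv.sum_comp (swapValue v)]
  refine Finset.sum_congr rfl fun x _ => ?_
  simp only [swapValue, Equiv.coe_fn_mk, gibbsMeasure, conditionalProb, Function.update_idem,
    Function.update_eq_self]
  ring

theorem sum_gibbsMeasure_mulVec [Nonempty V] [Nonempty S] (ε : (V → S) → ℝ)
    (f : (V → S) → ℝ) :
    ∑ I, gibbsMeasure ε I * (gibbsMatrix ε).mulVec f I = ∑ I, gibbsMeasure ε I * f I := by
  simp only [gibbsMatrix_mulVec]
  have h : ∀ I, gibbsMeasure ε I * ((Fintype.card V : ℝ)⁻¹ *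
      ∑ v, ∑ s, conditionalProb ε I v s * f (Function.update I v s)) =
      (Fintype.card V : ℝ)⁻¹ * ∑ v, gibbsMeasure ε I *
        ∑ s, conditionalProb ε I v s * f (Function.update I v s) := by
    intro I
    rw [Finset.mul_sum, Finset.mul_sum, Finset.mul_sum]
    refine Finset.sum_congr rfl fun v _ => ?_
    ring
  simp only [h]
  rw [← Finset.mul_sum, Finset.sum_comm]
  simp only [sum_gibbsMeasure_resample]
  simp

theorem gibbsMatrix_pow_succ_mulVec (ε : (V → S) → ℝ) (t : ℕ) (f : (V → S) → ℝ) :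
    (gibbsMatrix ε ^ (t + 1)).mulVec f =
      (gibbsMatrix ε).mulVec ((gibbsMatrix ε ^ t).mulVec f) := by
  rw [pow_succ', Matrix.mulVec_mulVec]

theorem gibbsMatrix_pow_mulVec_one [Nonempty V] [Nonempty S] (ε : (V → S) → ℝ) (t : ℕ) :
    (gibbsMatrix ε ^ t).mulVec 1 = 1 := by
  induction t with
  | zero => simp
  | succ t ih => rw [gibbsMatrix_pow_succ_mulVec, ih, gibbsMatrix_mulVec_one]

theorem gibbsMatrix_pow_nonneg (ε : (V → S) → ℝ) (t : ℕ) (I J : V → S) :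
    0 ≤ (gibbsMatrix ε ^ t) I J := by
  induction t generalizing I J with
  | zero => rw [pow_zero, Matrix.one_apply]; split_ifs <;> norm_num
  | succ t ih =>
    rw [pow_succ, Matrix.mul_apply]
    exact Finset.sum_nonneg fun K _ => mul_nonneg (ih I K) (gibbsMatrix_nonneg ε K J)

theorem sum_gibbsMatrix_pow [Nonempty V] [Nonempty S] (ε : (V → S) → ℝ) (t : ℕ) (I : V → S) :
    ∑ J, (gibbsMatrix ε ^ t) I J = 1 := by
  simpa [Matrix.mulVec, dotProduct] using congrFun (gibbsMatrix_pow_mulVec_one ε t) I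

theorem sum_gibbsMeasure_pow_mulVec [Nonempty V] [Nonempty S] (ε : (V → S) → ℝ)
    (f : (V → S) → ℝ) (t : ℕ) :
    ∑ I, gibbsMeasure ε I * (gibbsMatrix ε ^ t).mulVec f I = ∑ I, gibbsMeasure ε I * f I := by
  induction t with
  | zero => simp
  | succ t ih => rw [gibbsMatrix_pow_succ_mulVec, sum_gibbsMeasure_mulVec, ih]

theorem mulVec_indicator (P : Matrix (V → S) (V → S) ℝ) (A : Finset (V → S)) (x : V → S) :
    P.mulVec (fun y => if y ∈ A then 1 else 0) x = ∑ y ∈ A, P x y := by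
  simp [Matrix.mulVec, dotProduct]

/-- If the probabilities of every event after `t` steps differ by at most `1 / 4` for any two
initial worlds, then the mixing time is at most `t`. -/
theorem gibbsMixingTime_le [Nonempty V] [Nonempty S] (ε : (V → S) → ℝ) (t : ℕ)
    (h : ∀ (A : Finset (V → S)) (x y : V → S),
      |(gibbsMatrix ε ^ t).mulVec (fun z => if z ∈ A then 1 else 0) x -
        (gibbsMatrix ε ^ t).mulVec (fun z => if z ∈ A then 1 else 0) y| ≤ 1 / 4) :
    gibbsMixingTime ε ≤ t := by
  unfold gibbsMixingTime mixingTime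
  refine iInf₂_le t ?_
  intro x A
  set f : (V → S) → ℝ := fun z => if z ∈ A then 1 else 0 with hf
  -- By stationarity `π(A)` is the `π`-average, over initial worlds, of the probability of `A` at
  -- time `t`.
  have hπ : ∑ y ∈ A, gibbsMeasure ε y =
      ∑ y, gibbsMeasure ε y * (gibbsMatrix ε ^ t).mulVec f y := by
    rw [sum_gibbsMeasure_pow_mulVec]
    simp [hf]
  have hx : (gibbsMatrix ε ^ t).mulVec f x =
      ∑ y, gibbsMeasure ε y * (gibbsMatrix ε ^ t).mulVec f x := by
    rw [← Finset.sum_mul, sum_gibbsMeasure, one_mul]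
  rw [← mulVec_indicator, hπ, hx, ← Finset.sum_sub_distrib]
  calc _ ≤ ∑ y, |gibbsMeasure ε y * (gibbsMatrix ε ^ t).mulVec f x -
        gibbsMeasure ε y * (gibbsMatrix ε ^ t).mulVec f y| := Finset.abs_sum_le_sum_abs _ _
    _ ≤ ∑ y, gibbsMeasure ε y * (1 / 4) := by
        refine Finset.sum_le_sum fun y _ => ?_
        rw [← mul_sub, abs_mul, abs_of_nonneg (gibbsMeasure_nonneg ε y)]
        exact mul_le_mul_of_nonneg_left (h A x y) (gibbsMeasure_nonneg ε y)
    _ = 1 / 4 := by rw [← Finset.sum_mul, sum_gibbsMeasure, one_mul]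

theorem le_gibbsMixingTime (ε : (V → S) → ℝ) (T : ℕ∞)
    (h : ∀ t : ℕ, (∀ (x : V → S) (A : Finset (V → S)),
      |(∑ y ∈ A, (gibbsMatrix ε ^ t) x y) - ∑ y ∈ A, gibbsMeasure ε y| ≤ 1 / 4) →
      T ≤ (t : ℕ∞)) :
    T ≤ gibbsMixingTime ε := by
  unfold gibbsMixingTime mixingTime
  exact le_iInf₂ fun t ht => h t ht

end Markov

/-! ### Coupling and contraction for two-valued variables -/

section Coupling

variable {V : Type} [Fintype V] [DecidableEq V]

theorem conditionalProb_false (ε : (V → Bool) → ℝ) (x : V → Bool) (v : V) :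
    conditionalProb ε x v false = 1 - conditionalProb ε x v true := by
  have := sum_conditionalProb ε x v
  rw [Fintype.sum_bool] at this
  linarith

theorem conditionalProb_true_le_one (ε : (V → Bool) → ℝ) (x : V → Bool) (v : V) :
    conditionalProb ε x v true ≤ 1 := by
  have := conditionalProb_false ε x v
  have := conditionalProb_nonneg ε x v false
  linarith

theorem conditionalProb_true (ε : (V → Bool) → ℝ) (x : V → Bool) (v : V) :
    conditionalProb ε x v true =
      Real.sigmoid (ε (Function.update x v true) - ε (Function.update x v false)) := by
  unfold conditionalProb
  rw [Fintype.sum_bool, Real.sigmoid_def, neg_sub, Real.exp_sub]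
  have := Real.exp_pos (ε (Function.update x v true))
  have := Real.exp_pos (ε (Function.update x v false))
  field_simp

/-- The expectation of `Ψ` after one step of the coupled chains started at `x` and `y` that
resample the same variable, the two new values being maximally coupled. -/
noncomputable def coupledStep (ε : (V → Bool) → ℝ) (Ψ : (V → Bool) → (V → Bool) → ℝ)
    (x y : V → Bool) : ℝ :=
  (Fintype.card V : ℝ)⁻¹ * ∑ v,
    (min (conditionalProb ε x v true) (conditionalProb ε y v true) *
        Ψ (Function.update x v true) (Function.update y v true) +
      (1 - max (conditionalProb ε x v true) (conditionalProb ε y v true)) *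
        Ψ (Function.update x v false) (Function.update y v false) +
      (conditionalProb ε x v true -
          min (conditionalProb ε x v true) (conditionalProb ε y v true)) *
        Ψ (Function.update x v true) (Function.update y v false) +
      (conditionalProb ε y v true -
          min (conditionalProb ε x v true) (conditionalProb ε y v true)) *
        Ψ (Function.update x v false) (Function.update y v true))

/-- Both expectations are taken under the maximal coupling of two Bernoulli variables; one of the
two discordant terms always vanishes, which is the case split on `p ≤ q`. -/
theorem abs_coupled_sub_le {p q a₁ a₀ b₁ b₀ c₁₁ c₀₀ c₁₀ c₀₁ : ℝ} (hp0 : 0 ≤ p) (hp1 : p ≤ 1)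
    (hq0 : 0 ≤ q) (hq1 : q ≤ 1) (h₁₁ : |a₁ - b₁| ≤ c₁₁) (h₀₀ : |a₀ - b₀| ≤ c₀₀)
    (h₁₀ : |a₁ - b₀| ≤ c₁₀) (h₀₁ : |a₀ - b₁| ≤ c₀₁) :
    |(p * a₁ + (1 - p) * a₀) - (q * b₁ + (1 - q) * b₀)| ≤
      min p q * c₁₁ + (1 - max p q) * c₀₀ + (p - min p q) * c₁₀ + (q - min p q) * c₀₁ := by
  rw [abs_le] at *
  rcases le_total p q with h | h
  · rw [min_eq_left h, max_eq_right h]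
    constructor <;>
    nlinarith [mul_le_mul_of_nonneg_left h₁₁.1 hp0, mul_le_mul_of_nonneg_left h₁₁.2 hp0,
      mul_le_mul_of_nonneg_left h₀₀.1 (sub_nonneg.2 hq1),
      mul_le_mul_of_nonneg_left h₀₀.2 (sub_nonneg.2 hq1),
      mul_le_mul_of_nonneg_left h₀₁.1 (sub_nonneg.2 h),
      mul_le_mul_of_nonneg_left h₀₁.2 (sub_nonneg.2 h)]
  · rw [min_eq_right h, max_eq_left h]
    constructor <;>
    nlinarith [mul_le_mul_of_nonneg_left h₁₁.1 hq0, mul_le_mul_of_nonneg_left h₁₁.2 hq0,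
      mul_le_mul_of_nonneg_left h₀₀.1 (sub_nonneg.2 hp1),
      mul_le_mul_of_nonneg_left h₀₀.2 (sub_nonneg.2 hp1),
      mul_le_mul_of_nonneg_left h₁₀.1 (sub_nonneg.2 h),
      mul_le_mul_of_nonneg_left h₁₀.2 (sub_nonneg.2 h)]

/-- The coupling is used in dual form, through bounds on differences of test functions, so no joint
chain has to be constructed. -/
theorem abs_mulVec_sub_le_coupledStep (ε : (V → Bool) → ℝ) (f : (V → Bool) → ℝ)
    (Ψ : (V → Bool) → (V → Bool) → ℝ) (h : ∀ x y, |f x - f y| ≤ Ψ x y) (x y : V → Bool) :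
    |(gibbsMatrix ε).mulVec f x - (gibbsMatrix ε).mulVec f y| ≤ coupledStep ε Ψ x y := by
  rw [gibbsMatrix_mulVec, gibbsMatrix_mulVec, ← mul_sub, abs_mul, coupledStep,
    abs_of_nonneg (by positivity), ← Finset.sum_sub_distrib]
  refine mul_le_mul_of_nonneg_left ?_ (by positivity)
  refine (Finset.abs_sum_le_sum_abs _ _).trans (Finset.sum_le_sum fun v _ => ?_)
  rw [Fintype.sum_bool, Fintype.sum_bool, conditionalProb_false, conditionalProb_false]
  exact abs_coupled_sub_le (conditionalProb_nonneg ..) (conditionalProb_true_le_one ..)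
    (conditionalProb_nonneg ..) (conditionalProb_true_le_one ..) (h _ _) (h _ _) (h _ _) (h _ _)

theorem coupledStep_affine [Nonempty V] (ε : (V → Bool) → ℝ) (Ψ : (V → Bool) → (V → Bool) → ℝ)
    (a b : ℝ) (x y : V → Bool) :
    coupledStep ε (fun x y => a * Ψ x y + b) x y = a * coupledStep ε Ψ x y + b := by
  have hN : (Fintype.card V : ℝ) ≠ 0 := by simp
  have hb : b = (Fintype.card V : ℝ)⁻¹ * ∑ _v : V, b := by
    simp [hN]
  conv_rhs => rw [hb]
  rw [coupledStep, coupledStep, mul_left_comm, ← mul_add, Finset.mul_sum _ _ a,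
    ← Finset.sum_add_distrib]
  congr 1
  refine Finset.sum_congr rfl fun v _ => ?_
  have := min_add_max (conditionalProb ε x v true) (conditionalProb ε y v true)
  linear_combination (-b) * this

/-- The constant `η` is the fixed point of the affine drift. The bound at each time is an affine
function of `Ψ`, so `coupledStep_affine` lets the induction proceed. -/
theorem abs_pow_mulVec_sub_le [Nonempty V] (ε : (V → Bool) → ℝ)
    (Ψ : (V → Bool) → (V → Bool) → ℝ) {α η : ℝ} (hα : 0 ≤ α)
    (hΨ : ∀ x y, coupledStep ε Ψ x y ≤ α * Ψ x y + (1 - α) * η) (hη : 0 ≤ η)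
    (f : (V → Bool) → ℝ) (h : ∀ x y, |f x - f y| ≤ Ψ x y) (t : ℕ) (x y : V → Bool) :
    |(gibbsMatrix ε ^ t).mulVec f x - (gibbsMatrix ε ^ t).mulVec f y| ≤ α ^ t * Ψ x y + η := by
  have key : ∀ x y, |(gibbsMatrix ε ^ t).mulVec f x - (gibbsMatrix ε ^ t).mulVec f y| ≤
      α ^ t * Ψ x y + (1 - α ^ t) * η := by
    induction t with
    | zero => simpa using h
    | succ t ih =>
      intro x y
      rw [gibbsMatrix_pow_succ_mulVec]
      refine (abs_mulVec_sub_le_coupledStep ε _ _ ih x y).trans ?_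
      rw [coupledStep_affine, pow_succ]
      have := mul_le_mul_of_nonneg_left (hΨ x y) (pow_nonneg hα t)
      nlinarith
  refine (key x y).trans ?_
  have : 0 ≤ α ^ t * η := by positivity
  linarith

/-- The weighted Hamming distance. -/
noncomputable def weightedHamming (c : V → ℝ) (x y : V → Bool) : ℝ :=
  ∑ v, c v * if x v = y v then 0 else 1

theorem weightedHamming_update (c : V → ℝ) (x y : V → Bool) (v : V) (a b : Bool) :
    weightedHamming c (Function.update x v a) (Function.update y v b) =
      weightedHamming c x y - (c v * if x v = y v then 0 else 1) +
        c v * if a = b then 0 else 1 := by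
  unfold weightedHamming
  rw [← Finset.add_sum_erase _ _ (Finset.mem_univ v),
    ← Finset.add_sum_erase (a := v) _ (fun v => c v * if x v = y v then 0 else 1)
      (Finset.mem_univ v)]
  have : ∀ u ∈ Finset.univ.erase v,
      (c u * if Function.update x v a u = Function.update y v b u then (0:ℝ) else 1) =
        c u * if x u = y u then 0 else 1 := by
    intro u hu
    rw [Function.update_of_ne (Finset.ne_of_mem_erase hu),
      Function.update_of_ne (Finset.ne_of_mem_erase hu)]
  rw [Finset.sum_congr rfl this]
  simp only [Function.update_self]
  ring

/-- Resampling `v` erases a disagreement there and creates one with probability equal to the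
difference of the conditional probabilities; the terms in `G` see only the marginal chains. -/
theorem coupledStep_weightedHamming [Nonempty V] (ε : (V → Bool) → ℝ) (c : V → ℝ)
    (G : (V → Bool) → ℝ) (x y : V → Bool) :
    coupledStep ε (fun x y => weightedHamming c x y + G x + G y) x y =
      (1 - (Fintype.card V : ℝ)⁻¹) * weightedHamming c x y +
      (Fintype.card V : ℝ)⁻¹ *
        ∑ v, c v * |conditionalProb ε x v true - conditionalProb ε y v true| +
      (gibbsMatrix ε).mulVec G x + (gibbsMatrix ε).mulVec G y := by
  have hN : (Fintype.card V : ℝ) ≠ 0 := by simp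
  have hH : (1 - (Fintype.card V : ℝ)⁻¹) * weightedHamming c x y =
      (Fintype.card V : ℝ)⁻¹ * ∑ v, (weightedHamming c x y -
        c v * if x v = y v then 0 else 1) := by
    rw [Finset.sum_sub_distrib, ← weightedHamming, Finset.sum_const, Finset.card_univ,
      nsmul_eq_mul]
    field_simp
  rw [hH, gibbsMatrix_mulVec, gibbsMatrix_mulVec, coupledStep, ← mul_add, ← mul_add, ← mul_add,
    ← Finset.sum_add_distrib, ← Finset.sum_add_distrib, ← Finset.sum_add_distrib]
  congr 1
  refine Finset.sum_congr rfl fun v _ => ?_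
  simp only [weightedHamming_update, Fintype.sum_bool, conditionalProb_false]
  have h1 := min_add_max (conditionalProb ε x v true) (conditionalProb ε y v true)
  have h2 := max_sub_min_eq_abs (conditionalProb ε x v true) (conditionalProb ε y v true)
  rw [abs_sub_comm] at h2
  rw [← h2]
  have h3 : max (conditionalProb ε x v true) (conditionalProb ε y v true) =
    conditionalProb ε x v true + conditionalProb ε y v true -
     min (conditionalProb ε x v true) (conditionalProb ε y v true) := by linarith
  rw [h3]
  simp
  ring

end Coupling

theorem Real.abs_sigmoid_sub_le (a b : ℝ) : |Real.sigmoid a - Real.sigmoid b| ≤ |a - b| := by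
  have h : ∀ x ∈ (Set.univ : Set ℝ), ‖deriv Real.sigmoid x‖ ≤ 1 := by
    intro x _
    rw [deriv_sigmoid, Real.norm_eq_abs, abs_le]
    have h0 := Real.sigmoid_pos x
    have h1 := Real.sigmoid_lt_one x
    constructor <;> nlinarith
  simpa using convex_univ.norm_image_sub_le_of_norm_deriv_le
    (fun x _ => differentiable_sigmoid x) h (Set.mem_univ b) (Set.mem_univ a)

/-! ### The voting model: vote counts, strength increments and local log-odds -/

section VotingModel

/-- The voter with index `i` on the side `b`, where `true` is the side of the true-voters. -/
def VotingVar.voter {n : ℕ} : Bool → Fin n → VotingVar n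
  | true, i => VotingVar.T i
  | false, i => VotingVar.F i

theorem VotingVar.voter_ne_Q {n : ℕ} (b : Bool) (i : Fin n) : voter b i ≠ Q := by
  cases b <;> simp [voter]

theorem VotingVar.voter_injective {n : ℕ} (b : Bool) :
    Function.Injective (voter b : Fin n → VotingVar n) := by
  cases b <;> intro i j h <;> simpa [voter] using h

theorem VotingVar.voter_ne_voter {n : ℕ} {b c : Bool} (h : b ≠ c) (i j : Fin n) :
    voter b i ≠ voter c j := by
  cases b <;> cases c <;> simp_all [voter]

theorem VotingVar.card (n : ℕ) : Fintype.card (VotingVar n) = 2 * n + 1 := by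
  simp; ring

theorem VotingVar.sum_eq {n : ℕ} {M : Type*} [AddCommMonoid M] (f : VotingVar n → M) :
    ∑ v, f v = f Q + ∑ b, ∑ i, f (voter b i) := by
  simp [Fintype.sum_sum_type, voter]

theorem VotingVar.cases_voter {n : ℕ} (v : VotingVar n) :
    v = Q ∨ ∃ b i, v = voter b i := by
  rcases v with u | i | i
  · exact Or.inl rfl
  · exact Or.inr ⟨true, i, rfl⟩
  · exact Or.inr ⟨false, i, rfl⟩

open VotingVar

/-- The number of voters on the side `b` that have the value `1`. -/
def voteCount {n : ℕ} (b : Bool) (I : VotingWorld n) : ℕ :=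
  ∑ i, (I (voter b i)).toNat

/-- The strength of `s` votes. -/
noncomputable def VotingSemantics.profile : VotingSemantics → ℕ → ℝ
  | .linear, s => s
  | .logical, s => if s = 0 then 0 else 1
  | .ratio, s => Real.log (1 + s)

theorem voteCount_cast {n : ℕ} (b : Bool) (I : VotingWorld n) :
    (voteCount b I : ℝ) = ∑ i, voterValue (I (voter b i)) := by
  unfold voteCount voterValue
  push_cast
  refine Finset.sum_congr rfl fun i _ => ?_
  cases I (voter b i) <;> simp

theorem VotingSemantics.strength_eq (σ : VotingSemantics) {n : ℕ} (b : Bool)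
    (I : VotingWorld n) :
    σ.strength (fun i => voterValue (I (voter b i))) = σ.profile (voteCount b I) := by
  cases σ
  · simp [strength, profile, voteCount_cast]
  · simp only [strength, profile]
    rcases isEmpty_or_nonempty (Fin n) with hn | hn
    -- Without voters the supremum is the default value 0, in agreement with `profile`.
    · simp [Real.iSup_of_isEmpty, voteCount]
    by_cases h : voteCount b I = 0
    · rw [if_pos h]
      have h0 : ∀ i, voterValue (I (voter b i)) = 0 := by
        intro i
        have := (Finset.sum_eq_zero_iff.1 h) i (Finset.mem_univ i)
        revert this
        unfold voterValue
        cases I (voter b i) <;> simp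
      simp [h0]
    · rw [if_neg h]
      obtain ⟨i, -, hi⟩ := Finset.exists_ne_zero_of_sum_ne_zero h
      have hi1 : voterValue (I (voter b i)) = 1 := by
        revert hi
        unfold voterValue
        cases I (voter b i) <;> simp
      refine le_antisymm (ciSup_le fun j => ?_) ?_
      · unfold voterValue; split_ifs <;> norm_num
      · exact hi1 ▸ le_ciSup (f := fun i => voterValue (I (voter b i)))
          (Set.finite_range _).bddAbove i
  · simp [strength, profile, voteCount_cast]

theorem votingEnergy_eq (σ : VotingSemantics) {n : ℕ} (w : ℝ) (wT wF : Fin n → ℝ)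
    (I : VotingWorld n) :
    votingEnergy σ w wT wF I =
      w * queryValue (I Q) *
          (σ.profile (voteCount true I) - σ.profile (voteCount false I)) +
        (∑ i, wT i * voterValue (I (voter true i)) +
          ∑ i, wF i * voterValue (I (voter false i))) := by
  rw [← σ.strength_eq, ← σ.strength_eq]
  unfold votingEnergy
  simp only [voter]
  ring

theorem voteCount_update_Q {n : ℕ} (b c : Bool) (I : VotingWorld n) :
    voteCount b (Function.update I Q c) = voteCount b I := by
  unfold voteCount
  simp [Function.update_of_ne (voter_ne_Q b _)]

theorem voteCount_update_of_ne {n : ℕ} {b b' : Bool} (h : b ≠ b') (c : Bool) (i : Fin n)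
    (I : VotingWorld n) :
    voteCount b (Function.update I (voter b' i) c) = voteCount b I := by
  unfold voteCount
  simp [Function.update_of_ne (voter_ne_voter h _ i)]

theorem voteCount_update {n : ℕ} (b c : Bool) (i : Fin n) (I : VotingWorld n) :
    voteCount b (Function.update I (voter b i) c) + (I (voter b i)).toNat =
      voteCount b I + c.toNat := by
  unfold voteCount
  rw [← Finset.add_sum_erase _ _ (Finset.mem_univ i),
    ← Finset.add_sum_erase _ (fun j => (I (voter b j)).toNat) (Finset.mem_univ i)]
  have : ∀ j ∈ Finset.univ.erase i, (Function.update I (voter b i) c (voter b j)).toNat =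
      (I (voter b j)).toNat := by
    intro j hj
    rw [Function.update_of_ne ((voter_injective b).ne (Finset.ne_of_mem_erase hj))]
  rw [Finset.sum_congr rfl this]
  simp only [Function.update_self]
  ring

theorem voteCount_le {n : ℕ} (b : Bool) (I : VotingWorld n) : voteCount b I ≤ n := by
  unfold voteCount
  calc _ ≤ ∑ _i : Fin n, 1 := Finset.sum_le_sum fun i _ => Bool.toNat_le _
    _ = n := by simp

theorem sum_mul_voterValue_update {n : ℕ} (u : Fin n → ℝ) (b : Bool) (i : Fin n)
    (I : VotingWorld n) :
    ∑ j, u j * voterValue (Function.update I (voter b i) true (voter b j)) -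
      ∑ j, u j * voterValue (Function.update I (voter b i) false (voter b j)) = u i := by
  rw [← Finset.sum_sub_distrib, Finset.sum_eq_single i]
  · simp [voterValue]
  · intro j _ hj
    rw [Function.update_of_ne ((voter_injective b).ne hj),
      Function.update_of_ne ((voter_injective b).ne hj), sub_self]
  · simp

/-- The number of votes on the side of a voter, that voter left out. -/
def otherVotes {n : ℕ} (b : Bool) (i : Fin n) (I : VotingWorld n) : ℕ :=
  voteCount b (Function.update I (voter b i) false)

theorem voteCount_eq_otherVotes {n : ℕ} (b : Bool) (i : Fin n) (I : VotingWorld n) :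
    voteCount b I = otherVotes b i I + (I (voter b i)).toNat := by
  have := voteCount_update b false i I
  unfold otherVotes
  simp at this
  omega

/-- The increment of the strength of `s` votes by a further vote. -/
noncomputable def VotingSemantics.increment (σ : VotingSemantics) (s : ℕ) : ℝ :=
  σ.profile (s + 1) - σ.profile s

/-- These are the log-odds of a voter (`conditionalProb_true`). The prior enters as a constant and
cancels when two worlds are compared. -/
theorem energy_update_voter (σ : VotingSemantics) {n : ℕ} (w : ℝ) (wT wF : Fin n → ℝ)
    (b : Bool) (i : Fin n) (I : VotingWorld n) :
    votingEnergy σ w wT wF (Function.update I (voter b i) true) -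
      votingEnergy σ w wT wF (Function.update I (voter b i) false) =
    w * queryValue (I Q) * queryValue b * σ.increment (otherVotes b i I) +
      (if b then wT i else wF i) := by
  have h1 : voteCount b (Function.update I (voter b i) true) = otherVotes b i I + 1 := by
    have h := voteCount_update b true i I
    have h' := voteCount_eq_otherVotes b i I
    simp at h
    omega
  have h2 : voteCount b (Function.update I (voter b i) false) = otherVotes b i I := rfl
  have hQ : ∀ c, Function.update I (voter b i) c Q = I Q := fun c =>
    Function.update_of_ne (voter_ne_Q b i).symm _ _
  rw [votingEnergy_eq, votingEnergy_eq, hQ, hQ, VotingSemantics.increment]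
  have h3 : ∀ c, voteCount (!b) (Function.update I (voter b i) c) = voteCount (!b) I :=
    fun c => voteCount_update_of_ne (by simp) c i I
  have h4 : ∀ u : Fin n → ℝ, ∀ c, ∑ j, u j * voterValue (Function.update I (voter b i) c
      (voter (!b) j)) = ∑ j, u j * voterValue (I (voter (!b) j)) := by
    intro u c
    refine Finset.sum_congr rfl fun j _ => ?_
    rw [Function.update_of_ne (voter_ne_voter (by simp) _ _)]
  cases b
  · have h5 := sum_mul_voterValue_update wF false i I
    simp only [Bool.not_false] at h3 h4
    rw [h1, h2, h3, h3, h4, h4]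
    simp only [queryValue, Bool.false_eq_true, if_false]
    linear_combination h5
  · have h5 := sum_mul_voterValue_update wT true i I
    simp only [Bool.not_true] at h3 h4
    rw [h1, h2, h3, h3, h4, h4]
    simp only [queryValue, if_true]
    linear_combination h5

theorem energy_update_Q (σ : VotingSemantics) {n : ℕ} (w : ℝ) (wT wF : Fin n → ℝ)
    (I : VotingWorld n) :
    votingEnergy σ w wT wF (Function.update I Q true) -
      votingEnergy σ w wT wF (Function.update I Q false) =
    2 * w * (σ.profile (voteCount true I) - σ.profile (voteCount false I)) := by
  rw [votingEnergy_eq, votingEnergy_eq]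
  simp only [voteCount_update_Q, Function.update_of_ne (voter_ne_Q _ _), Function.update_self,
    queryValue]
  simp
  ring

theorem VotingSemantics.increment_nonneg (σ : VotingSemantics) (s : ℕ) : 0 ≤ σ.increment s := by
  cases σ <;> simp only [increment, profile]
  · simp
  · split_ifs <;> simp_all
  · rw [sub_nonneg]
    exact Real.log_le_log (by positivity) (by push_cast; linarith)

theorem VotingSemantics.increment_ratio (s : ℕ) :
    ratio.increment s = Real.log (1 + 1 / (1 + s)) := by
  simp only [increment, profile]
  rw [← Real.log_div (by positivity) (by positivity)]
  congr 1
  push_cast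
  field_simp
  ring

/-- This decay and `increment_sub_le` are all that the fast mixing argument uses of the logical and
ratio semantics. The decay is what fails for linear semantics, where every increment is 1. -/
theorem VotingSemantics.increment_le_of_ne {σ : VotingSemantics} (hσ : σ ≠ .linear) (s : ℕ) :
    σ.increment s ≤ 1 / (1 + s) := by
  cases σ
  · exact absurd rfl hσ
  · simp only [increment, profile]
    rcases Nat.eq_zero_or_pos s with rfl | h
    · simp
    · rw [if_neg (by omega), if_neg (by omega)]
      simp; positivity
  · rw [increment_ratio]
    have h : (0:ℝ) < 1 + 1 / (1 + s) := by positivity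
    linarith [Real.log_le_sub_one_of_pos h]

theorem VotingSemantics.increment_le_one (σ : VotingSemantics) (s : ℕ) : σ.increment s ≤ 1 := by
  by_cases hσ : σ = .linear
  · subst hσ; simp [increment, profile]
  · refine (increment_le_of_ne hσ s).trans ?_
    rw [div_le_one (by positivity)]
    linarith [(Nat.cast_nonneg s : (0:ℝ) ≤ s)]

theorem VotingSemantics.increment_sub_le {σ : VotingSemantics} (hσ : σ ≠ .linear) {s t : ℕ}
    (hst : s ≤ t) :
    |σ.increment s - σ.increment t| ≤ 2 * (t - s) / ((1 + s) * (1 + t)) := by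
  have hst' : (s : ℝ) ≤ t := by exact_mod_cast hst
  cases σ
  · exact absurd rfl hσ
  · simp only [increment, profile]
    rcases Nat.eq_zero_or_pos t with rfl | ht
    · obtain rfl : s = 0 := by omega
      simp
    have ht' : (1 : ℝ) ≤ t := by exact_mod_cast ht
    rw [if_neg (show s + 1 ≠ 0 by omega), if_neg (show t + 1 ≠ 0 by omega),
      if_neg (show t ≠ 0 by omega)]
    -- The factor 2 is needed at `s = 0`: the difference of increments is 1, and the bound `2 t / (1
    -- + t)` equals 1 at `t = 1`.
    rcases Nat.eq_zero_or_pos s with rfl | h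
    · simp
      rw [le_div_iff₀ (by positivity)]
      linarith
    · rw [if_neg (by omega)]
      simp only [sub_self, abs_zero]
      exact div_nonneg (by linarith) (by positivity)
  · rw [increment_ratio, increment_ratio, abs_of_nonneg, ← Real.log_div (by positivity)
      (by positivity)]
    · refine (Real.log_le_sub_one_of_pos (by positivity)).trans ?_
      rw [div_sub_one (by positivity)]
      rw [div_le_div_iff₀ (by positivity) (by positivity)]
      have e : (1 + 1 / (1 + (s:ℝ)) - (1 + 1 / (1 + (t:ℝ)))) * ((1 + s) * (1 + t)) = t - s := by
        field_simp
        ring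
      rw [e]
      have h0 : (0:ℝ) ≤ 1 / (1 + t) := by positivity
      nlinarith
    · rw [sub_nonneg]
      refine Real.log_le_log (by positivity) ?_
      gcongr

theorem VotingSemantics.profile_sub_le (σ : VotingSemantics) {s t : ℕ} {c : ℝ} (hst : s ≤ t)
    (hc : ∀ k, s ≤ k → σ.increment k ≤ c) :
    |σ.profile s - σ.profile t| ≤ c * (t - s) := by
  have h : 0 ≤ σ.profile t - σ.profile s ∧ σ.profile t - σ.profile s ≤ c * (t - s) := by
    induction t, hst using Nat.le_induction with
    | base => simp
    | succ t hst ih =>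
      have h1 := hc t hst
      have h2 := σ.increment_nonneg t
      unfold increment at h1 h2
      push_cast
      constructor <;> nlinarith
  rw [abs_sub_comm, abs_of_nonneg h.1]
  exact h.2

theorem abs_queryValue (b : Bool) : |queryValue b| = 1 := by
  cases b <;> simp [queryValue]

/-- The weights of a voting model are bounded by `ω`. -/
structure WeightBound {n : ℕ} (ω w : ℝ) (wT wF : Fin n → ℝ) : Prop where
  nonneg : 0 ≤ w
  le : w ≤ ω
  abs_prior_le : ∀ (b : Bool) (i : Fin n), |if b then wT i else wF i| ≤ ω

variable {n : ℕ} {ω w : ℝ} {wT wF : Fin n → ℝ}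

theorem WeightBound.abs_voter_le (h : WeightBound ω w wT wF) (σ : VotingSemantics) (b : Bool)
    (i : Fin n) (I : VotingWorld n) :
    |votingEnergy σ w wT wF (Function.update I (voter b i) true) -
      votingEnergy σ w wT wF (Function.update I (voter b i) false)| ≤ 2 * ω := by
  rw [energy_update_voter]
  refine (abs_add_le _ _).trans ?_
  have h1 := h.abs_prior_le b i
  have h2 : |w * queryValue (I Q) * queryValue b * σ.increment (otherVotes b i I)| ≤ ω := by
    rw [abs_mul, abs_mul, abs_mul, abs_queryValue, abs_queryValue, abs_of_nonneg h.nonneg,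
      abs_of_nonneg (σ.increment_nonneg _)]
    nlinarith [h.nonneg, h.le, σ.increment_nonneg (otherVotes b i I),
      σ.increment_le_one (otherVotes b i I)]
  linarith

theorem WeightBound.abs_query_le (h : WeightBound ω w wT wF) (σ : VotingSemantics)
    (I : VotingWorld n) :
    |votingEnergy σ w wT wF (Function.update I Q true) -
      votingEnergy σ w wT wF (Function.update I Q false)| ≤ 2 * ω * n := by
  rw [energy_update_Q, abs_mul, abs_mul, abs_of_nonneg h.nonneg, abs_two]
  have key : |σ.profile (voteCount true I) - σ.profile (voteCount false I)| ≤ n := by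
    have h1 : (voteCount true I : ℝ) ≤ n := by exact_mod_cast voteCount_le true I
    have h2 : (voteCount false I : ℝ) ≤ n := by exact_mod_cast voteCount_le false I
    have h3 : (0:ℝ) ≤ voteCount true I := by positivity
    have h4 : (0:ℝ) ≤ voteCount false I := by positivity
    rcases le_total (voteCount true I) (voteCount false I) with hle | hle
    · have := σ.profile_sub_le hle (c := 1) fun k _ => σ.increment_le_one k
      linarith
    · have := σ.profile_sub_le hle (c := 1) fun k _ => σ.increment_le_one k
      rw [abs_sub_comm]
      linarith
  have h5 : 0 ≤ 2 * ω := by linarith [h.nonneg, h.le]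
  have := h.le
  gcongr

theorem sigmoid_neg_le_conditionalProb {V : Type} [Fintype V] [DecidableEq V]
    (ε : (V → Bool) → ℝ) (x : V → Bool) (v : V) {c : ℝ}
    (h : |ε (Function.update x v true) - ε (Function.update x v false)| ≤ c) (b : Bool) :
    Real.sigmoid (-c) ≤ conditionalProb ε x v b := by
  have h' := abs_le.1 h
  cases b
  · rw [conditionalProb_false, conditionalProb_true, ← Real.sigmoid_neg]
    exact Real.sigmoid_le (by linarith)
  · rw [conditionalProb_true]
    exact Real.sigmoid_le h'.1

end VotingModel

/-! ### Drift of the vote deficit and contraction of the penalized distance -/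

section Contraction

open VotingVar

variable {n : ℕ} {ω w : ℝ} {wT wF : Fin n → ℝ}

/-- The number of votes on the side `b` that are missing for a total of `m`. -/
def voteDeficit {n : ℕ} (m : ℕ) (b : Bool) (I : VotingWorld n) : ℕ := m - voteCount b I

theorem cube_deficit_succ_le (m s : ℕ) :
    ((m - (s + 1) : ℕ) : ℝ) ^ 3 - ((m - s : ℕ) : ℝ) ^ 3 ≤ -((m - s : ℕ) : ℝ) ^ 2 := by
  rcases Nat.lt_or_ge s m with h | h
  · obtain ⟨k, hk⟩ : ∃ k, m - s = k + 1 := ⟨m - s - 1, by omega⟩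
    have hk' : m - (s + 1) = k := by omega
    rw [hk, hk']
    push_cast
    nlinarith [(Nat.cast_nonneg k : (0:ℝ) ≤ k)]
  · have h1 : m - s = 0 := by omega
    have h2 : m - (s + 1) = 0 := by omega
    rw [h1, h2]; simp

theorem cube_deficit_pred_le (m s : ℕ) :
    ((m - s : ℕ) : ℝ) ^ 3 - ((m - (s + 1) : ℕ) : ℝ) ^ 3 ≤
      7 * ((m - (s + 1) : ℕ) : ℝ) ^ 2 + if m - (s + 1) = 0 then 1 else 0 := by
  have h : ((m - s : ℕ) : ℝ) ≤ ((m - (s + 1) : ℕ) : ℝ) + 1 := by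
    exact_mod_cast (by omega : m - s ≤ m - (s + 1) + 1)
  have h3 := pow_le_pow_left₀ (Nat.cast_nonneg _) h 3
  split_ifs with h0
  · rw [h0] at h3 ⊢
    simpa using h3
  · have h1 : (1:ℝ) ≤ ((m - (s + 1) : ℕ) : ℝ) := by
      exact_mod_cast Nat.one_le_iff_ne_zero.2 h0
    nlinarith

/-- A voter at 0 becomes 1 with probability at least the sigmoid term, which lowers the cube by the
square or more. A voter at 1 raises it by at most 7 squares; the 8 makes up for the square
subtracted from every voter alike. -/
theorem resample_cube_deficit_le (h : WeightBound ω w wT wF) (σ : VotingSemantics) (m : ℕ)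
    (b : Bool) (i : Fin n) (x : VotingWorld n) :
    ∑ s, conditionalProb (votingEnergy σ w wT wF) x (voter b i) s *
        (voteDeficit m b (Function.update x (voter b i) s) : ℝ) ^ 3 ≤
      (voteDeficit m b x : ℝ) ^ 3 - Real.sigmoid (-(2 * ω)) * (voteDeficit m b x : ℝ) ^ 2 +
        ((x (voter b i)).toNat : ℝ) * (8 * (voteDeficit m b x : ℝ) ^ 2 +
          if voteDeficit m b x = 0 then 1 else 0) := by
  set p := conditionalProb (votingEnergy σ w wT wF) x (voter b i) true with hp
  have hp0 : Real.sigmoid (-(2 * ω)) ≤ p :=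
    sigmoid_neg_le_conditionalProb _ _ _ (h.abs_voter_le σ b i x) true
  have hσ0 := Real.sigmoid_pos (-(2 * ω))
  have hσ1 := Real.sigmoid_lt_one (-(2 * ω))
  have hp1 : p ≤ 1 := conditionalProb_true_le_one ..
  rw [Fintype.sum_bool, conditionalProb_false, ← hp]
  have e1 := voteCount_update b true i x
  have e2 := voteCount_update b false i x
  unfold voteDeficit
  cases hx : x (voter b i)
  · simp only [hx, Bool.toNat_false, Bool.toNat_true, add_zero] at e1 e2
    have h1 := cube_deficit_succ_le m (voteCount b x)
    rw [e1, e2]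
    simp only [Bool.toNat_false, Nat.cast_zero, zero_mul, add_zero]
    nlinarith [mul_le_mul_of_nonneg_left h1 (hσ0.le.trans hp0),
      mul_le_mul_of_nonneg_right hp0 (sq_nonneg ((m - voteCount b x : ℕ) : ℝ))]
  · simp only [hx, Bool.toNat_false, Bool.toNat_true, add_zero, add_left_inj] at e1 e2
    have h1 := cube_deficit_pred_le m (voteCount b (Function.update x (voter b i) false))
    rw [← e2] at e1 ⊢
    rw [e1]
    simp only [Bool.toNat_true, Nat.cast_one, one_mul]
    set k := voteCount b (Function.update x (voter b i) false)
    have hnn : (0:ℝ) ≤ 7 * ((m - (k + 1) : ℕ) : ℝ) ^ 2 + if m - (k + 1) = 0 then 1 else 0 := by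
      split_ifs <;> positivity
    nlinarith [mul_le_mul_of_nonneg_left h1 (sub_nonneg.2 hp1),
      mul_nonneg (hσ0.le.trans hp0) hnn, sq_nonneg ((m - (k + 1) : ℕ) : ℝ)]

/-- While the deficit is positive, at most `m` voters of the side are at 1, and `16 m ≤ p n` lets
them use up only half of the gain `n p z²`; the other half, divided by `2 n + 1`, is at least `p z²
/ 6`. At deficit 0 each vote costs at most 1, whence the final `+ 1`. -/
theorem mulVec_cube_deficit_le (h : WeightBound ω w wT wF) (σ : VotingSemantics) {m : ℕ}
    (hn : 1 ≤ n) (hm : 16 * (m : ℝ) ≤ Real.sigmoid (-(2 * ω)) * n) (b : Bool)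
    (x : VotingWorld n) :
    (gibbsMatrix (votingEnergy σ w wT wF)).mulVec (fun x => (voteDeficit m b x : ℝ) ^ 3) x ≤
      (voteDeficit m b x : ℝ) ^ 3 -
        Real.sigmoid (-(2 * ω)) / 6 * (voteDeficit m b x : ℝ) ^ 2 + 1 := by
  set p := Real.sigmoid (-(2 * ω)) with hp
  have hσ0 : 0 < p := Real.sigmoid_pos (-(2 * ω))
  set z : ℝ := (voteDeficit m b x : ℝ) with hz
  set e : ℝ := if voteDeficit m b x = 0 then 1 else 0 with he
  have hn' : (1:ℝ) ≤ n := by exact_mod_cast hn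
  have hs : (voteCount b x : ℝ) = ∑ i, ((x (voter b i)).toNat : ℝ) := by
    unfold voteCount; push_cast; rfl
  have hside : ∑ i, ∑ s, conditionalProb (votingEnergy σ w wT wF) x (voter b i) s *
        (voteDeficit m b (Function.update x (voter b i) s) : ℝ) ^ 3 ≤
      n * (z ^ 3 - p * z ^ 2) + voteCount b x * (8 * z ^ 2 + e) := by
    refine (Finset.sum_le_sum fun i _ => resample_cube_deficit_le h σ m b i x).trans ?_
    rw [Finset.sum_add_distrib, ← Finset.sum_mul, ← hs]
    rw [Finset.sum_const, Finset.card_univ, Fintype.card_fin, nsmul_eq_mul]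
  have hother : ∑ i, ∑ s, conditionalProb (votingEnergy σ w wT wF) x (voter (!b) i) s *
        (voteDeficit m b (Function.update x (voter (!b) i) s) : ℝ) ^ 3 = n * z ^ 3 := by
    simp only [voteDeficit, voteCount_update_of_ne (show b ≠ !b by simp), ← Finset.sum_mul,
      sum_conditionalProb]
    simp [hz, voteDeficit]
  have hQ : ∑ s, conditionalProb (votingEnergy σ w wT wF) x Q s *
        (voteDeficit m b (Function.update x Q s) : ℝ) ^ 3 = z ^ 3 := by
    simp only [voteDeficit, voteCount_update_Q, ← Finset.sum_mul, sum_conditionalProb]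
    simp [hz, voteDeficit]
  rw [gibbsMatrix_mulVec, VotingVar.sum_eq, hQ, VotingVar.card]
  have hb : ∀ g : Bool → ℝ, ∑ c, g c = g b + g (!b) := by
    intro g; cases b <;> simp [add_comm]
  rw [hb, hother]
  push_cast
  rw [inv_mul_le_iff₀ (by positivity)]
  have key : -(n * p * z ^ 2) + voteCount b x * (8 * z ^ 2 + e) ≤
      (2 * n + 1) * (-(p / 6 * z ^ 2) + 1) := by
    have hc : (voteCount b x : ℝ) ≤ n := by exact_mod_cast voteCount_le b x
    by_cases h0 : voteDeficit m b x = 0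
    · have hz0 : z = 0 := by rw [hz, h0]; simp
      have he1 : e = 1 := by rw [he, if_pos h0]
      rw [hz0, he1]
      nlinarith
    · have he0 : e = 0 := by rw [he, if_neg h0]
      have hlt : (voteCount b x : ℝ) ≤ m := by
        have : voteCount b x ≤ m := by unfold voteDeficit at h0; omega
        exact_mod_cast this
      rw [he0]
      have h1 : 8 * (voteCount b x : ℝ) ≤ p * n / 2 := by linarith
      have h2 := mul_le_mul_of_nonneg_right h1 (sq_nonneg z)
      have h3 : 0 ≤ p * z ^ 2 * (n - 1) := by
        apply mul_nonneg (by positivity); linarith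
      nlinarith
  linarith

/-- The number of disagreements of two worlds on the side `b`. -/
def sideHamming {n : ℕ} (b : Bool) (x y : VotingWorld n) : ℝ :=
  ∑ i, if x (voter b i) = y (voter b i) then 0 else 1

/-- The indicator of a disagreement at the query variable. -/
def queryHamming {n : ℕ} (x y : VotingWorld n) : ℝ := if x Q = y Q then 0 else 1

theorem sideHamming_nonneg (b : Bool) (x y : VotingWorld n) : 0 ≤ sideHamming b x y :=
  Finset.sum_nonneg fun i _ => by split_ifs <;> norm_num

theorem sideHamming_le (b : Bool) (x y : VotingWorld n) : sideHamming b x y ≤ n := by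
  calc sideHamming b x y ≤ ∑ _i : Fin n, (1:ℝ) :=
        Finset.sum_le_sum fun i _ => by split_ifs <;> norm_num
    _ = n := by simp

theorem queryHamming_nonneg (x y : VotingWorld n) : 0 ≤ queryHamming x y := by
  unfold queryHamming; split_ifs <;> norm_num

theorem queryHamming_le_one (x y : VotingWorld n) : queryHamming x y ≤ 1 := by
  unfold queryHamming; split_ifs <;> norm_num

theorem abs_voteCount_sub_le (b : Bool) (x y : VotingWorld n) :
    |(voteCount b x : ℝ) - voteCount b y| ≤ sideHamming b x y := by
  unfold voteCount sideHamming
  push_cast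
  rw [← Finset.sum_sub_distrib]
  refine (Finset.abs_sum_le_sum_abs _ _).trans (Finset.sum_le_sum fun i _ => ?_)
  cases x (voter b i) <;> cases y (voter b i) <;> simp

theorem abs_otherVotes_sub_le (b : Bool) (i : Fin n) (x y : VotingWorld n) :
    |(otherVotes b i x : ℝ) - otherVotes b i y| ≤ sideHamming b x y := by
  refine (abs_voteCount_sub_le b _ _).trans (Finset.sum_le_sum fun j _ => ?_)
  by_cases hj : voter b j = voter b i
  · rw [hj]
    simp only [Function.update_self, if_true]
    split_ifs <;> norm_num
  · rw [Function.update_of_ne hj, Function.update_of_ne hj]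

theorem abs_queryValue_sub_le (x y : VotingWorld n) :
    |queryValue (x Q) - queryValue (y Q)| ≤ 2 * queryHamming x y := by
  unfold queryHamming queryValue
  cases x Q <;> cases y Q <;> norm_num

theorem VotingSemantics.abs_increment_sub_le {σ : VotingSemantics} (hσ : σ ≠ .linear) {s t m : ℕ}
    (hm : 0 < m) (hs : m ≤ 2 * (1 + s)) (ht : m ≤ 2 * (1 + t)) :
    |σ.increment s - σ.increment t| ≤ 8 / m ^ 2 * |(s : ℝ) - t| := by
  wlog h : s ≤ t generalizing s t
  · rw [abs_sub_comm, abs_sub_comm (s : ℝ)]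
    exact this ht hs (by omega)
  refine (increment_sub_le hσ h).trans ?_
  have hst : (s : ℝ) ≤ t := by exact_mod_cast h
  have hs' : (m : ℝ) ≤ 2 * (1 + s) := by exact_mod_cast hs
  have ht' : (m : ℝ) ≤ 2 * (1 + t) := by exact_mod_cast ht
  have hm' : (0 : ℝ) < m := by exact_mod_cast hm
  rw [abs_sub_comm, abs_of_nonneg (sub_nonneg.2 hst), div_mul_eq_mul_div,
    div_le_div_iff₀ (by positivity) (by positivity)]
  have h1 : (m : ℝ) ^ 2 ≤ 4 * ((1 + s) * (1 + t)) := by nlinarith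
  nlinarith [mul_le_mul_of_nonneg_left h1 (sub_nonneg.2 hst)]

theorem VotingSemantics.increment_le_two_div {σ : VotingSemantics} (hσ : σ ≠ .linear) {s m : ℕ}
    (hm : 0 < m) (hs : m ≤ 2 * (1 + s)) : σ.increment s ≤ 2 / m := by
  refine (increment_le_of_ne hσ s).trans ?_
  have hs' : (m : ℝ) ≤ 2 * (1 + s) := by exact_mod_cast hs
  have hm' : (0 : ℝ) < m := by exact_mod_cast hm
  rw [div_le_div_iff₀ (by positivity) hm']
  linarith

theorem VotingSemantics.abs_profile_sub_le {σ : VotingSemantics} (hσ : σ ≠ .linear) {s t m : ℕ}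
    (hm : 0 < m) (hs : m ≤ 2 * s) (ht : m ≤ 2 * t) :
    |σ.profile s - σ.profile t| ≤ 2 / m * |(s : ℝ) - t| := by
  wlog h : s ≤ t generalizing s t
  · rw [abs_sub_comm, abs_sub_comm (s : ℝ)]
    exact this ht hs (by omega)
  have hst : (s : ℝ) ≤ t := by exact_mod_cast h
  rw [abs_sub_comm (s : ℝ), abs_of_nonneg (sub_nonneg.2 hst)]
  exact σ.profile_sub_le h fun k hk => increment_le_two_div hσ hm (by omega)

theorem abs_conditionalProb_voter_sub_le (h : WeightBound ω w wT wF) {σ : VotingSemantics}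
    (hσ : σ ≠ .linear) {m : ℕ} (hm : 0 < m) {b : Bool} {x y : VotingWorld n}
    (hx : m ≤ 2 * voteCount b x) (hy : m ≤ 2 * voteCount b y) (i : Fin n) :
    |conditionalProb (votingEnergy σ w wT wF) x (voter b i) true -
      conditionalProb (votingEnergy σ w wT wF) y (voter b i) true| ≤
      ω * (4 / m * queryHamming x y + 8 / m ^ 2 * sideHamming b x y) := by
  rw [conditionalProb_true, conditionalProb_true]
  refine (Real.abs_sigmoid_sub_le _ _).trans ?_
  rw [energy_update_voter, energy_update_voter]
  have hm' : (0 : ℝ) < m := by exact_mod_cast hm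
  -- The voter itself may be among the counted votes, hence the `1 +`.
  have hs : m ≤ 2 * (1 + otherVotes b i x) := by
    have := voteCount_eq_otherVotes b i x
    have := Bool.toNat_le (x (voter b i))
    omega
  have ht : m ≤ 2 * (1 + otherVotes b i y) := by
    have := voteCount_eq_otherVotes b i y
    have := Bool.toNat_le (y (voter b i))
    omega
  set s := otherVotes b i x
  set t := otherVotes b i y
  -- Change the query at a fixed increment, then the increment at a fixed query.
  have e : w * queryValue (x Q) * queryValue b * σ.increment s + (if b then wT i else wF i) -
      (w * queryValue (y Q) * queryValue b * σ.increment t + (if b then wT i else wF i)) =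
      w * queryValue b * ((queryValue (x Q) - queryValue (y Q)) * σ.increment s +
        queryValue (y Q) * (σ.increment s - σ.increment t)) := by ring
  rw [e, abs_mul, abs_mul, abs_queryValue, abs_of_nonneg h.nonneg, mul_one]
  refine mul_le_mul h.le ?_ (abs_nonneg _) (h.nonneg.trans h.le)
  refine (abs_add_le _ _).trans (add_le_add ?_ ?_)
  · rw [abs_mul, abs_of_nonneg (σ.increment_nonneg s)]
    calc _ ≤ 2 * queryHamming x y * (2 / m) :=
          mul_le_mul (abs_queryValue_sub_le x y)
            (VotingSemantics.increment_le_two_div hσ hm hs) (σ.increment_nonneg s)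
            (by have := queryHamming_nonneg x y; positivity)
      _ = _ := by ring
  · rw [abs_mul, abs_queryValue, one_mul]
    refine (VotingSemantics.abs_increment_sub_le hσ hm hs ht).trans ?_
    exact mul_le_mul_of_nonneg_left (abs_otherVotes_sub_le b i x y) (by positivity)

theorem abs_conditionalProb_query_sub_le (h : WeightBound ω w wT wF) {σ : VotingSemantics}
    (hσ : σ ≠ .linear) {m : ℕ} (hm : 0 < m) {x y : VotingWorld n}
    (hx : ∀ b, m ≤ 2 * voteCount b x) (hy : ∀ b, m ≤ 2 * voteCount b y) :
    |conditionalProb (votingEnergy σ w wT wF) x Q true -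
      conditionalProb (votingEnergy σ w wT wF) y Q true| ≤
      4 * ω / m * ∑ b, sideHamming b x y := by
  rw [conditionalProb_true, conditionalProb_true]
  refine (Real.abs_sigmoid_sub_le _ _).trans ?_
  rw [energy_update_Q, energy_update_Q]
  have e : 2 * w * (σ.profile (voteCount true x) - σ.profile (voteCount false x)) -
      2 * w * (σ.profile (voteCount true y) - σ.profile (voteCount false y)) =
      2 * w * ((σ.profile (voteCount true x) - σ.profile (voteCount true y)) -
        (σ.profile (voteCount false x) - σ.profile (voteCount false y))) := by ring
  have hm' : (0 : ℝ) < m := by exact_mod_cast hm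
  have key : ∀ b, |σ.profile (voteCount b x) - σ.profile (voteCount b y)| ≤
      2 / m * sideHamming b x y := fun b =>
    (VotingSemantics.abs_profile_sub_le hσ hm (hx b) (hy b)).trans
      (mul_le_mul_of_nonneg_left (abs_voteCount_sub_le b x y) (by positivity))
  have h1 := (abs_sub (σ.profile (voteCount true x) - σ.profile (voteCount true y))
    (σ.profile (voteCount false x) - σ.profile (voteCount false y))).trans
    (add_le_add (key true) (key false))
  rw [e, abs_mul, abs_mul, abs_two, abs_of_nonneg h.nonneg, Fintype.sum_bool]
  calc _ ≤ 2 * ω * (2 / m * sideHamming true x y + 2 / m * sideHamming false x y) := by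
        have := h.le
        have := h.nonneg
        exact mul_le_mul (by linarith) h1 (abs_nonneg _) (by linarith)
    _ = _ := by ring

/-- The weight `A` at the query variable and `1` at the voters. -/
def coordWeight {n : ℕ} (A : ℝ) : VotingVar n → ℝ
  | Sum.inl _ => A
  | Sum.inr _ => 1

theorem coordWeight_Q (A : ℝ) : coordWeight A (Q : VotingVar n) = A := rfl

theorem coordWeight_voter (A : ℝ) (b : Bool) (i : Fin n) : coordWeight A (voter b i) = 1 := by
  cases b <;> rfl

theorem weightedHamming_coordWeight (A : ℝ) (x y : VotingWorld n) :
    weightedHamming (coordWeight A) x y =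
      A * queryHamming x y + ∑ b, sideHamming b x y := by
  unfold weightedHamming
  rw [VotingVar.sum_eq]
  simp [coordWeight_Q, coordWeight_voter, queryHamming, sideHamming]

/-- A Dobrushin-type influence bound. A disagreement at the query costs at most `8 ω ρ` over all
voters, half of its weight `A`; one at a voter costs `8 ω ρ / m` on its side and `4 A ω / m` at the
query, together at most half of its weight 1. -/
theorem sum_coordWeight_mul_le (h : WeightBound ω w wT wF) {σ : VotingSemantics}
    (hσ : σ ≠ .linear) {m : ℕ} (hm : 0 < m) {ρ A : ℝ} (hρ : (n : ℝ) ≤ ρ * m)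
    (hA : 16 * ω * ρ ≤ A) (hA0 : 0 ≤ A) (hmA : 2 * (8 * ω * ρ + 4 * A * ω) ≤ m)
    {x y : VotingWorld n}
    (hx : ∀ b, m ≤ 2 * voteCount b x) (hy : ∀ b, m ≤ 2 * voteCount b y) :
    ∑ v, coordWeight A v * |conditionalProb (votingEnergy σ w wT wF) x v true -
      conditionalProb (votingEnergy σ w wT wF) y v true| ≤
      1 / 2 * weightedHamming (coordWeight A) x y := by
  have hm' : (0 : ℝ) < m := by exact_mod_cast hm
  have hω : 0 ≤ ω := h.nonneg.trans h.le
  have hq := queryHamming_nonneg x y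
  rw [VotingVar.sum_eq, weightedHamming_coordWeight, coordWeight_Q]
  have hv : ∀ b, ∑ i : Fin n, coordWeight A (voter b i) *
      |conditionalProb (votingEnergy σ w wT wF) x (voter b i) true -
      conditionalProb (votingEnergy σ w wT wF) y (voter b i) true| ≤
      ω * (4 * ρ * queryHamming x y + 8 * ρ / m * sideHamming b x y) := by
    intro b
    have hD := sideHamming_nonneg b x y
    calc _ ≤ ∑ i : Fin n, ω * (4 / m * queryHamming x y + 8 / m ^ 2 * sideHamming b x y) := by
          refine Finset.sum_le_sum fun i _ => ?_
          rw [coordWeight_voter, one_mul]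
          exact abs_conditionalProb_voter_sub_le h hσ hm (hx b) (hy b) i
      _ = n * (ω * (4 / m * queryHamming x y + 8 / m ^ 2 * sideHamming b x y)) := by simp
      _ ≤ ρ * m * (ω * (4 / m * queryHamming x y + 8 / m ^ 2 * sideHamming b x y)) :=
          mul_le_mul_of_nonneg_right hρ (by positivity)
      _ = _ := by field_simp
  have h1 := mul_le_mul_of_nonneg_left (abs_conditionalProb_query_sub_le h hσ hm hx hy) hA0
  have h2 := hv true
  have h3 := hv false
  have hS : 0 ≤ ∑ b, sideHamming b x y := Finset.sum_nonneg fun b _ => sideHamming_nonneg b x y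
  have h4 : (8 * ω * ρ + 4 * A * ω) / m * ∑ b, sideHamming b x y ≤
      1 / 2 * ∑ b, sideHamming b x y := by
    refine mul_le_mul_of_nonneg_right ?_ hS
    rw [div_le_iff₀ hm']
    linarith
  have h5 : 8 * ω * ρ * queryHamming x y ≤ A / 2 * queryHamming x y :=
    mul_le_mul_of_nonneg_right (by linarith) hq
  simp only [Fintype.sum_bool] at *
  have h6 : A * (4 * ω / m * (sideHamming true x y + sideHamming false x y)) +
    (ω * (4 * ρ * queryHamming x y + 8 * ρ / m * sideHamming true x y) +
     ω * (4 * ρ * queryHamming x y + 8 * ρ / m * sideHamming false x y)) =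
     8 * ω * ρ * queryHamming x y +
      (8 * ω * ρ + 4 * A * ω) / m * (sideHamming true x y + sideHamming false x y) := by
    field_simp
    ring
  linarith

theorem sum_coordWeight_mul_le_card {A : ℝ} (hA0 : 0 ≤ A) (ε : VotingWorld n → ℝ)
    (x y : VotingWorld n) :
    ∑ v, coordWeight A v * |conditionalProb ε x v true - conditionalProb ε y v true| ≤
      (2 * n + 1) * (1 + A) := by
  have h1 : ∀ v, |conditionalProb ε x v true - conditionalProb ε y v true| ≤ 1 := by
    intro v
    have := conditionalProb_nonneg ε x v true
    have := conditionalProb_nonneg ε y v true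
    have := conditionalProb_true_le_one ε x v
    have := conditionalProb_true_le_one ε y v
    rw [abs_le]; constructor <;> linarith
  have h2 : ∀ v : VotingVar n, 0 ≤ coordWeight A v ∧ coordWeight A v ≤ 1 + A := by
    rintro (v | v) <;> simp [coordWeight, hA0]
  calc _ ≤ ∑ v : VotingVar n, (1 + A) := Finset.sum_le_sum fun v _ => by
        nlinarith [h1 v, (h2 v).1, (h2 v).2,
          abs_nonneg (conditionalProb ε x v true - conditionalProb ε y v true)]
    _ = _ := by
        rw [Finset.sum_const, Finset.card_univ, VotingVar.card, nsmul_eq_mul]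
        push_cast; ring

/-- The penalty for worlds with few votes on one of the sides. -/
noncomputable def deficitPenalty {n : ℕ} (m : ℕ) (M : ℝ) (x : VotingWorld n) : ℝ :=
  M * ∑ b, (voteDeficit m b x : ℝ) ^ 3

/-- Half of the quadratic drift pays for the factor `1 - 1 / (2 (2 n + 1))` on the cube, because the
deficit is at most `m ≤ p n / 16`; the other half is kept for bad worlds. -/
theorem mulVec_deficitPenalty_le (h : WeightBound ω w wT wF) (σ : VotingSemantics) {m : ℕ}
    (hn : 1 ≤ n) (hm0 : 0 < m) (hm : 16 * (m : ℝ) ≤ Real.sigmoid (-(2 * ω)) * n) {M : ℝ}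
    (hM : 0 ≤ M) (x : VotingWorld n) :
    (gibbsMatrix (votingEnergy σ w wT wF)).mulVec (deficitPenalty m M) x ≤
      (1 - ((2 * n + 1 : ℝ))⁻¹ / 2) * deficitPenalty m M x + 2 * M -
        M * (Real.sigmoid (-(2 * ω)) / 12) * ∑ b, (voteDeficit m b x : ℝ) ^ 2 := by
  have e : (deficitPenalty m M : VotingWorld n → ℝ) =
      M • ((fun x => (voteDeficit m true x : ℝ) ^ 3) +
        (fun x => (voteDeficit m false x : ℝ) ^ 3)) := by
    ext x; simp [deficitPenalty]
  rw [e, Matrix.mulVec_smul, Matrix.mulVec_add]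
  simp only [Pi.smul_apply, Pi.add_apply, smul_eq_mul, Fintype.sum_bool]
  have hm' : (0 : ℝ) < m := by exact_mod_cast hm0
  have hn' : (1:ℝ) ≤ n := by exact_mod_cast hn
  have hp := Real.sigmoid_pos (-(2 * ω))
  set p := Real.sigmoid (-(2 * ω)) with hpdef
  have key : ∀ b, (gibbsMatrix (votingEnergy σ w wT wF)).mulVec
      (fun x => (voteDeficit m b x : ℝ) ^ 3) x ≤
      (1 - ((2 * n + 1 : ℝ))⁻¹ / 2) * (voteDeficit m b x : ℝ) ^ 3 -
        p / 12 * (voteDeficit m b x : ℝ) ^ 2 + 1 := by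
    intro b
    refine (mulVec_cube_deficit_le h σ hn hm b x).trans ?_
    have hz : (voteDeficit m b x : ℝ) ≤ m := by
      exact_mod_cast Nat.sub_le m (voteCount b x)
    have hz0 : (0:ℝ) ≤ voteDeficit m b x := by positivity
    set z : ℝ := (voteDeficit m b x : ℝ)
    have h1 : ((2 * n + 1 : ℝ))⁻¹ / 2 * m ≤ p / 12 := by
      rw [inv_eq_one_div, div_div, div_mul_eq_mul_div, one_mul, div_le_div_iff₀ (by positivity)
        (by norm_num)]
      nlinarith
    have h2 : ((2 * n + 1 : ℝ))⁻¹ / 2 * z ^ 3 ≤ p / 12 * z ^ 2 := by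
      have h3 : ((2 * n + 1 : ℝ))⁻¹ / 2 * z ≤ p / 12 :=
        (mul_le_mul_of_nonneg_left hz (by positivity)).trans h1
      calc _ = ((2 * n + 1 : ℝ))⁻¹ / 2 * z * z ^ 2 := by ring
        _ ≤ _ := mul_le_mul_of_nonneg_right h3 (sq_nonneg z)
    linarith
  have h4 := mul_le_mul_of_nonneg_left (add_le_add (key true) (key false)) hM
  nlinarith

/-- If both worlds have at least `m / 2` votes on each side, the influence bound contracts the
distance. Otherwise the step adds at most `1 + A` in expectation, and a side with deficit at least
`m / 2` yields a drift of at least `M p m² / 48 ≥ 1 + A`. The term `4 M` is the drift error of the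
two penalties. -/
theorem coupledStep_voting_le (h : WeightBound ω w wT wF) {σ : VotingSemantics}
    (hσ : σ ≠ .linear) {m : ℕ} (hn : 1 ≤ n) (hm : 0 < m)
    (hmn : 16 * (m : ℝ) ≤ Real.sigmoid (-(2 * ω)) * n) {ρ A M : ℝ} (hρ : (n : ℝ) ≤ ρ * m)
    (hA : 16 * ω * ρ ≤ A) (hA0 : 0 ≤ A) (hmA : 2 * (8 * ω * ρ + 4 * A * ω) ≤ m)
    (hM : 48 * (1 + A) ≤ M * (Real.sigmoid (-(2 * ω)) * m ^ 2)) (hM0 : 0 ≤ M)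
    (x y : VotingWorld n) :
    coupledStep (votingEnergy σ w wT wF)
      (fun x y => weightedHamming (coordWeight A) x y + deficitPenalty m M x +
        deficitPenalty m M y) x y ≤
      (1 - ((2 * n + 1 : ℝ))⁻¹ / 2) * (weightedHamming (coordWeight A) x y +
        deficitPenalty m M x + deficitPenalty m M y) + 4 * M := by
  rw [coupledStep_weightedHamming, VotingVar.card]
  have hp := Real.sigmoid_pos (-(2 * ω))
  have hx := mulVec_deficitPenalty_le h σ hn hm hmn hM0 x
  have hy := mulVec_deficitPenalty_le h σ hn hm hmn hM0 y
  push_cast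
  have hN : (0:ℝ) < 2 * n + 1 := by positivity
  have hpen : ∀ x : VotingWorld n,
      0 ≤ M * (Real.sigmoid (-(2 * ω)) / 12) * ∑ b, (voteDeficit m b x : ℝ) ^ 2 :=
    fun x => by positivity
  have hH : 0 ≤ weightedHamming (coordWeight A) x y := by
    rw [weightedHamming_coordWeight]
    have := queryHamming_nonneg x y
    have : 0 ≤ ∑ b, sideHamming b x y :=
      Finset.sum_nonneg fun b _ => sideHamming_nonneg b x y
    positivity
  by_cases hgood : (∀ b, m ≤ 2 * voteCount b x) ∧ (∀ b, m ≤ 2 * voteCount b y)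
  · have h1 := mul_le_mul_of_nonneg_left
      (sum_coordWeight_mul_le h hσ hm hρ hA hA0 hmA hgood.1 hgood.2) (inv_nonneg.2 hN.le)
    linarith [hpen x, hpen y]
  · have h1 := mul_le_mul_of_nonneg_left
      (sum_coordWeight_mul_le_card hA0 (votingEnergy σ w wT wF) x y) (inv_nonneg.2 hN.le)
    rw [inv_mul_cancel_left₀ hN.ne'] at h1
    have hbad : ∀ x : VotingWorld n, (¬ ∀ b, m ≤ 2 * voteCount b x) →
        1 + A ≤ M * (Real.sigmoid (-(2 * ω)) / 12) * ∑ b, (voteDeficit m b x : ℝ) ^ 2 := by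
      intro x hx
      push Not at hx
      obtain ⟨b, hb⟩ := hx
      have hz : (m : ℝ) ≤ 2 * voteDeficit m b x := by
        exact_mod_cast (by unfold voteDeficit; omega : m ≤ 2 * voteDeficit m b x)
      have h2 : (voteDeficit m b x : ℝ) ^ 2 ≤ ∑ b, (voteDeficit m b x : ℝ) ^ 2 :=
        Finset.single_le_sum (f := fun b => (voteDeficit m b x : ℝ) ^ 2)
          (fun b _ => sq_nonneg _) (Finset.mem_univ b)
      have h3 : (m : ℝ) ^ 2 / 4 ≤ (voteDeficit m b x : ℝ) ^ 2 := by
        nlinarith [(Nat.cast_nonneg m : (0:ℝ) ≤ m)]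
      have h4 := mul_le_mul_of_nonneg_left (h3.trans h2)
        (by positivity : 0 ≤ M * (Real.sigmoid (-(2 * ω)) / 12))
      linarith
    have hpos : 0 ≤ (2 * (n:ℝ) + 1)⁻¹ * weightedHamming (coordWeight A) x y :=
      mul_nonneg (inv_nonneg.2 hN.le) hH
    rcases not_and_or.1 hgood with hb | hb
    · linarith [hpen y, hbad x hb]
    · linarith [hpen x, hbad y hb]

end Contraction

/-! ### The bound `O(n log n)` for logical and ratio semantics -/

section FastMixing

open VotingVar

variable {n : ℕ} {ω w : ℝ} {wT wF : Fin n → ℝ}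

theorem deficitPenalty_nonneg {m : ℕ} {M : ℝ} (hM : 0 ≤ M) (x : VotingWorld n) :
    0 ≤ deficitPenalty m M x := by
  unfold deficitPenalty; positivity

theorem deficitPenalty_le {m : ℕ} {M : ℝ} (hM : 0 ≤ M) (x : VotingWorld n) :
    deficitPenalty m M x ≤ 2 * (M * m ^ 3) := by
  unfold deficitPenalty
  have h : ∀ b, (voteDeficit m b x : ℝ) ^ 3 ≤ (m : ℝ) ^ 3 := fun b =>
    pow_le_pow_left₀ (Nat.cast_nonneg _) (by exact_mod_cast Nat.sub_le m (voteCount b x)) 3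
  rw [Fintype.sum_bool]
  nlinarith [mul_le_mul_of_nonneg_left (add_le_add (h true) (h false)) hM]

theorem weightedHamming_coordWeight_le {A : ℝ} (hA : 0 ≤ A) (x y : VotingWorld n) :
    weightedHamming (coordWeight A) x y ≤ A + 2 * n := by
  rw [weightedHamming_coordWeight, Fintype.sum_bool]
  nlinarith [queryHamming_le_one x y, sideHamming_le true x y, sideHamming_le false x y]

theorem abs_indicator_sub_le {A : ℝ} (hA : 1 ≤ A) (S : Finset (VotingWorld n))
    (x y : VotingWorld n) :
    |(if x ∈ S then (1:ℝ) else 0) - (if y ∈ S then 1 else 0)| ≤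
      weightedHamming (coordWeight A) x y := by
  have hnn : ∀ v, 0 ≤ coordWeight A v * if x v = y v then (0:ℝ) else 1 := by
    rintro (v | v) <;> simp only [coordWeight] <;> split_ifs <;> linarith
  by_cases hxy : x = y
  · subst hxy
    simp [weightedHamming]
  · obtain ⟨v, hv⟩ := Function.ne_iff.1 hxy
    have h1 : (1:ℝ) ≤ coordWeight A v * if x v = y v then (0:ℝ) else 1 := by
      rw [if_neg hv, mul_one]
      rcases v with v | v <;> simp [coordWeight, hA]
    refine le_trans ?_ (h1.trans (Finset.single_le_sum (fun v _ => hnn v) (Finset.mem_univ v)))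
    split_ifs <;> norm_num

theorem gibbsMixingTime_voting_le (h : WeightBound ω w wT wF) {σ : VotingSemantics}
    (hσ : σ ≠ .linear) {m : ℕ} (hn : 1 ≤ n) (hm : 0 < m)
    (hmn : 16 * (m : ℝ) ≤ Real.sigmoid (-(2 * ω)) * n) {ρ A : ℝ} (hρ : (n : ℝ) ≤ ρ * m)
    (hA : 16 * ω * ρ ≤ A) (hA1 : 1 ≤ A) (hmA : 2 * (8 * ω * ρ + 4 * A * ω) ≤ m)
    (hm2 : 9216 * ρ * (1 + A) ≤ Real.sigmoid (-(2 * ω)) * m)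
    {t : ℕ} (ht : 4 * (2 * n + 1) * Real.log n ≤ t) (hn2 : 8 * (14 + 13 * A) ≤ n) :
    gibbsMixingTime (votingEnergy σ w wT wF) ≤ t := by
  have hp := Real.sigmoid_pos (-(2 * ω))
  set p := Real.sigmoid (-(2 * ω)) with hpdef
  have hm' : (0 : ℝ) < m := by exact_mod_cast hm
  have hn' : (1:ℝ) ≤ n := by exact_mod_cast hn
  -- The least `M` for which the drift compensates in bad worlds.
  obtain ⟨M, hMdef⟩ : ∃ M : ℝ, M = 48 * (1 + A) / (p * m ^ 2) := ⟨_, rfl⟩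
  have hM0 : 0 ≤ M := by rw [hMdef]; positivity
  have hM : M * (p * m ^ 2) = 48 * (1 + A) := by rw [hMdef]; field_simp
  have hN : (0:ℝ) < 2 * n + 1 := by positivity
  have hNinv : ((2 * n + 1 : ℝ))⁻¹ ≤ 1 := inv_le_one_of_one_le₀ (by linarith)
  have hNinv0 : 0 < ((2 * n + 1 : ℝ))⁻¹ := inv_pos.2 hN
  set α : ℝ := 1 - ((2 * n + 1 : ℝ))⁻¹ / 2 with hα
  -- The fixed point `4 M / (1 - α)`, of order `1 / m`. It takes one half of the allowed `1 / 4`; `α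
  -- ^ t` times the initial distance takes the other.
  have hη : 8 * (2 * n + 1) * M ≤ 1 / 8 := by
    have hρ0 : 0 ≤ ρ := by
      by_contra hneg
      nlinarith [mul_neg_of_neg_of_pos (not_le.1 hneg) hm']
    have h1 : 8 * (2 * n + 1) * M ≤ 24 * (ρ * m) * M :=
      mul_le_mul_of_nonneg_right (by linarith) hM0
    have h2 : 24 * (ρ * m) * M = 1152 * ρ * (1 + A) / (p * m) := by
      rw [hMdef]; field_simp; ring
    rw [h2] at h1
    refine h1.trans ?_
    rw [div_le_div_iff₀ (by positivity) (by norm_num)]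
    linarith
  have hΨ : ∀ x y : VotingWorld n, weightedHamming (coordWeight A) x y +
      deficitPenalty m M x + deficitPenalty m M y ≤ (14 + 13 * A) * n := by
    intro x y
    have h1 := weightedHamming_coordWeight_le (by linarith : 0 ≤ A) x y
    have h2 := deficitPenalty_le (m := m) hM0 x
    have h3 := deficitPenalty_le (m := m) hM0 y
    have h4 : 4 * (M * m ^ 3) ≤ 12 * (1 + A) * n := by
      have : 4 * (M * m ^ 3) * p = 12 * (1 + A) * (16 * m) := by
        linear_combination 4 * m * hM
      have h5 : 4 * (M * m ^ 3) * p ≤ 12 * (1 + A) * n * p := by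
        rw [this]
        nlinarith
      exact le_of_mul_le_mul_right h5 hp
    nlinarith
  have hαt : α ^ t ≤ 1 / (n:ℝ) ^ 2 := by
    have h1 : α ≤ Real.exp (-(((2 * n + 1 : ℝ))⁻¹ / 2)) := by
      have := Real.add_one_le_exp (-(((2 * n + 1 : ℝ))⁻¹ / 2))
      linarith
    calc α ^ t ≤ Real.exp (-(((2 * n + 1 : ℝ))⁻¹ / 2)) ^ t :=
          pow_le_pow_left₀ (by linarith) h1 t
      _ = Real.exp (t * (-(((2 * n + 1 : ℝ))⁻¹ / 2))) := by rw [← Real.exp_nat_mul]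
      _ ≤ Real.exp (-(2 * Real.log n)) := by
          rw [Real.exp_le_exp]
          have : ((2 * n + 1 : ℝ))⁻¹ / 2 * (4 * (2 * n + 1) * Real.log n) = 2 * Real.log n := by
            field_simp; ring
          have h2 := mul_le_mul_of_nonneg_left ht (by positivity : 0 ≤ ((2 * n + 1 : ℝ))⁻¹ / 2)
          linarith
      _ = 1 / (n:ℝ) ^ 2 := by
          rw [Real.exp_neg, two_mul, Real.exp_add, Real.exp_log (by linarith), one_div, sq]
  refine gibbsMixingTime_le _ _ fun S x y => ?_
  refine (abs_pow_mulVec_sub_le _ (fun x y => weightedHamming (coordWeight A) x y +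
    deficitPenalty m M x + deficitPenalty m M y) (α := α) (η := 8 * (2 * n + 1) * M)
    (by linarith) ?_ (by positivity) _ ?_ t x y).trans ?_
  · intro x y
    refine (coupledStep_voting_le h hσ hn hm hmn hρ hA (by linarith) hmA hM.ge hM0 x y).trans ?_
    have : (1 - α) * (8 * (2 * n + 1) * M) = 4 * M := by
      rw [hα]; field_simp; ring
    rw [this]
  · intro x y
    have := abs_indicator_sub_le hA1 S x y
    have := deficitPenalty_nonneg (m := m) hM0 x
    have := deficitPenalty_nonneg (m := m) hM0 y
    linarith
  · have h1 : α ^ t * (weightedHamming (coordWeight A) x y +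
        deficitPenalty m M x + deficitPenalty m M y) ≤ 1 / 8 := by
      calc _ ≤ 1 / (n:ℝ) ^ 2 * ((14 + 13 * A) * n) :=
            (mul_le_mul_of_nonneg_left (hΨ x y) (pow_nonneg (by linarith) t)).trans
              (mul_le_mul_of_nonneg_right hαt (by positivity))
        _ = (14 + 13 * A) / n := by field_simp
        _ ≤ 1 / 8 := by
            rw [div_le_div_iff₀ (by linarith) (by norm_num)]
            linarith
    linarith

theorem WeightBound.of_mem {ω w : ℝ} {wT wF : Fin n → ℝ} (hw : 0 < w)
    (hwω : w ∈ Set.Icc (-ω) ω) (hT : ∀ i, wT i ∈ Set.Icc (-ω) ω)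
    (hF : ∀ i, wF i ∈ Set.Icc (-ω) ω) : WeightBound ω w wT wF where
  nonneg := hw.le
  le := hwω.2
  abs_prior_le b i := by
    cases b
    · simpa [abs_le] using hF i
    · simpa [abs_le] using hT i

/-- Under logical and ratio semantics the mixing times are `O (n log n)`. -/
theorem exists_votingMixingTimes_le {σ : VotingSemantics} (hσ : σ ≠ .linear) {ω : ℝ}
    (hω : 0 < ω) :
    ∀ᶠ n : ℕ in atTop, ∀ τ ∈ votingMixingTimes σ ω n,
      ∃ t : ℕ, τ ≤ t ∧ (t : ℝ) ≤ 13 * (n * Real.log n) := by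
  have hp := Real.sigmoid_pos (-(2 * ω))
  set p := Real.sigmoid (-(2 * ω)) with hpdef
  -- With `m = ⌊p n / 16⌋` rounding loses at most half once `p n ≥ 32`, so `n ≤ ρ m`.
  obtain ⟨ρ, hρ⟩ : ∃ ρ : ℝ, ρ = 32 / p := ⟨_, rfl⟩
  have hρ0 : 0 < ρ := by rw [hρ]; positivity
  obtain ⟨A, hA⟩ : ∃ A : ℝ, A = 16 * ω * ρ + 1 := ⟨_, rfl⟩
  have hev := (tendsto_natCast_atTop_atTop (R := ℝ)).eventually_ge_atTop
  filter_upwards [hev ρ, hev (ρ * (2 * (8 * ω * ρ + 4 * A * ω))),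
    hev (ρ * (9216 * ρ * (1 + A) / p)), hev (8 * (14 + 13 * A)), eventually_ge_atTop 3]
    with n h1 h2 h3 h4 h5
  rintro τ ⟨w, wT, wF, hw, hwω, hT, hF, rfl⟩
  have h5' : (3:ℝ) ≤ n := by exact_mod_cast h5
  have hlog : 1 ≤ Real.log n := by
    rw [Real.le_log_iff_exp_le (by linarith)]
    linarith [Real.exp_one_lt_d9]
  have hfl : ((⌊p * n / 16⌋₊ : ℕ) : ℝ) ≤ p * n / 16 := Nat.floor_le (by positivity)
  have hfl2 : p * n / 16 < (⌊p * n / 16⌋₊ : ℕ) + 1 := Nat.lt_floor_add_one _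
  set m := ⌊p * n / 16⌋₊ with hm
  have hpn : 32 ≤ p * n := by
    rw [hρ, div_le_iff₀ hp] at h1
    linarith
  have hρm : (n:ℝ) ≤ ρ * m := by
    rw [hρ, div_mul_eq_mul_div, le_div_iff₀ hp]
    linarith
  have hmρ : ∀ a : ℝ, ρ * a ≤ n → a ≤ m := fun a ha =>
    le_of_mul_le_mul_left (ha.trans hρm) hρ0
  have hm1 : (0:ℝ) < m := by linarith
  refine ⟨⌈4 * (2 * n + 1) * Real.log n⌉₊, ?_, ?_⟩
  · refine gibbsMixingTime_voting_le (.of_mem hw hwω hT hF) hσ (m := m) (by omega)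
      (by exact_mod_cast hm1) (by linarith) hρm (A := A) (by linarith) ?_ (hmρ _ h2) ?_
      (Nat.le_ceil _) h4
    · rw [hA]
      have : 0 < 16 * ω * ρ := by positivity
      linarith
    · have := hmρ _ h3
      rw [div_le_iff₀ hp] at this
      linarith
  · have := Nat.ceil_lt_add_one (by positivity : 0 ≤ 4 * (2 * n + 1) * Real.log n)
    nlinarith

end FastMixing

/-! ### Doeblin minorization -/

section Doeblin

variable {V S : Type} [Fintype V] [DecidableEq V] [Fintype S] [DecidableEq S]

/-- Each of the `W.card!` orders of resampling every variable of `W` once, to its value in `y`, is a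
path from `x` to `y`. The induction splits off the first variable. -/
theorem le_gibbsMatrix_pow_card (ε : (V → S) → ℝ) (p : V → ℝ) (hp0 : ∀ v, 0 ≤ p v)
    (hp : ∀ I v s, p v ≤ conditionalProb ε I v s) (W : Finset V) (x y : V → S)
    (hxy : ∀ v ∉ W, x v = y v) :
    (W.card.factorial : ℝ) * ((Fintype.card V : ℝ)⁻¹) ^ W.card * ∏ v ∈ W, p v ≤
      (gibbsMatrix ε ^ W.card) x y := by
  induction hk : W.card generalizing W x with
  | zero =>
    obtain rfl : W = ∅ := Finset.card_eq_zero.1 hk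
    obtain rfl : x = y := funext fun v => hxy v (Finset.notMem_empty v)
    simp
  | succ k ih =>
    have hrec : (gibbsMatrix ε ^ (k + 1)) x y =
        (gibbsMatrix ε).mulVec (fun z => (gibbsMatrix ε ^ k) z y) x := by
      rw [pow_succ', Matrix.mul_apply]; rfl
    rw [hrec, gibbsMatrix_mulVec]
    have hnn : ∀ v s, 0 ≤ conditionalProb ε x v s *
        (gibbsMatrix ε ^ k) (Function.update x v s) y := fun v s =>
      mul_nonneg (conditionalProb_nonneg ..) (gibbsMatrix_pow_nonneg ..)
    have hterm : ∀ v ∈ W, (k.factorial : ℝ) * ((Fintype.card V : ℝ)⁻¹) ^ k * ∏ v ∈ W, p v ≤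
        ∑ s, conditionalProb ε x v s * (gibbsMatrix ε ^ k) (Function.update x v s) y := by
      intro v hv
      have h1 := ih (W.erase v) (Function.update x v (y v)) (by
        intro u hu
        by_cases huv : u = v
        · subst huv; simp
        · rw [Function.update_of_ne huv]
          exact hxy u fun huW => hu (Finset.mem_erase.2 ⟨huv, huW⟩))
        (by rw [Finset.card_erase_of_mem hv, hk]; rfl)
      calc _ = p v * ((k.factorial : ℝ) * ((Fintype.card V : ℝ)⁻¹) ^ k *
              ∏ v ∈ W.erase v, p v) := by
            rw [← Finset.mul_prod_erase W p hv]; ring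
        _ ≤ conditionalProb ε x v (y v) *
              (gibbsMatrix ε ^ k) (Function.update x v (y v)) y := by
            refine mul_le_mul (hp x v (y v)) h1 ?_ (conditionalProb_nonneg ..)
            exact mul_nonneg (by positivity) (Finset.prod_nonneg fun v _ => hp0 v)
        _ ≤ _ := Finset.single_le_sum (f := fun s => conditionalProb ε x v s *
              (gibbsMatrix ε ^ k) (Function.update x v s) y)
              (fun s _ => hnn v s) (Finset.mem_univ (y v))
    have h2 := (Finset.sum_le_sum hterm).trans
      (Finset.sum_le_sum_of_subset_of_nonneg (Finset.subset_univ W) fun v _ _ =>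
        Finset.sum_nonneg fun s _ => hnn v s)
    rw [Finset.sum_const, hk, nsmul_eq_mul] at h2
    refine le_trans (le_of_eq ?_) (mul_le_mul_of_nonneg_left h2 (by positivity))
    rw [Nat.factorial_succ, pow_succ]
    push_cast
    ring

/-- All rows share the mass `δ` at `z`, which contributes equally to both expectations. What remains
has mass `1 - δ` and acts on `f` minus its minimum, with values in `[0, D]`. -/
theorem abs_pow_mulVec_sub_le_of_le [Nonempty V] [Nonempty S] (ε : (V → S) → ℝ) {k : ℕ} {δ : ℝ}
    {z : V → S} (hδ : ∀ x, δ ≤ (gibbsMatrix ε ^ k) x z) {f : (V → S) → ℝ} {D : ℝ}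
    (hf : ∀ x y, |f x - f y| ≤ D) (x y : V → S) :
    |(gibbsMatrix ε ^ k).mulVec f x - (gibbsMatrix ε ^ k).mulVec f y| ≤ (1 - δ) * D := by
  obtain ⟨u, hu⟩ := Finite.exists_min f
  have hfu : ∀ v, 0 ≤ f v - f u ∧ f v - f u ≤ D := fun v =>
    ⟨sub_nonneg.2 (hu v), (le_abs_self _).trans (hf v u)⟩
  have key : ∀ x, δ * (f z - f u) ≤ (gibbsMatrix ε ^ k).mulVec f x - f u ∧
      (gibbsMatrix ε ^ k).mulVec f x - f u ≤ δ * (f z - f u) + (1 - δ) * D := by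
    intro x
    have hsum := sum_gibbsMatrix_pow ε k x
    have e : (gibbsMatrix ε ^ k).mulVec f x - f u =
        ∑ v, ((gibbsMatrix ε ^ k) x v - if v = z then δ else 0) * (f v - f u) +
          δ * (f z - f u) := by
      simp only [sub_mul, Finset.sum_sub_distrib, ite_mul, zero_mul, Finset.sum_ite_eq',
        Finset.mem_univ, if_true]
      simp only [mul_sub, Finset.sum_sub_distrib, ← Finset.sum_mul, hsum]
      simp [Matrix.mulVec, dotProduct]
    have hnn : ∀ v, 0 ≤ (gibbsMatrix ε ^ k) x v - if v = z then δ else 0 := by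
      intro v
      split_ifs with h
      · subst h; exact sub_nonneg.2 (hδ x)
      · rw [sub_zero]; exact gibbsMatrix_pow_nonneg ..
    have htot : ∑ v, ((gibbsMatrix ε ^ k) x v - if v = z then δ else 0) = 1 - δ := by
      rw [Finset.sum_sub_distrib, hsum]; simp
    have h1 : 0 ≤ ∑ v, ((gibbsMatrix ε ^ k) x v - if v = z then δ else 0) * (f v - f u) :=
      Finset.sum_nonneg fun v _ => mul_nonneg (hnn v) (hfu v).1
    have h2 : ∑ v, ((gibbsMatrix ε ^ k) x v - if v = z then δ else 0) * (f v - f u) ≤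
        (1 - δ) * D := by
      rw [← htot, Finset.sum_mul]
      exact Finset.sum_le_sum fun v _ => mul_le_mul_of_nonneg_left (hfu v).2 (hnn v)
    rw [e]
    constructor <;> linarith
  have hx := key x
  have hy := key y
  rw [abs_le]
  constructor <;> linarith

/-- If some world has probability at least `δ` after `k` steps from every initial world, then the
mixing time is at most `k * j` for `j ≥ 2 / δ`. -/
theorem gibbsMixingTime_le_of_le [Nonempty V] [Nonempty S] (ε : (V → S) → ℝ) {k j : ℕ} {δ : ℝ}
    {z : V → S} (hδ0 : 0 < δ) (hδ : ∀ x, δ ≤ (gibbsMatrix ε ^ k) x z) (hj : 2 / δ ≤ j) :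
    gibbsMixingTime ε ≤ (k * j : ℕ) := by
  refine gibbsMixingTime_le _ _ fun A x y => ?_
  have hδ1 : δ ≤ 1 := (hδ z).trans (by
    rw [← sum_gibbsMatrix_pow ε k z]
    exact Finset.single_le_sum (f := fun v => (gibbsMatrix ε ^ k) z v)
      (fun v _ => gibbsMatrix_pow_nonneg ..) (Finset.mem_univ z))
  set f : (V → S) → ℝ := fun z => if z ∈ A then 1 else 0 with hf
  have key : ∀ i : ℕ, ∀ x y, |(gibbsMatrix ε ^ (k * i)).mulVec f x -
      (gibbsMatrix ε ^ (k * i)).mulVec f y| ≤ (1 - δ) ^ i := by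
    intro i
    induction i with
    | zero =>
      intro x y
      simp only [mul_zero, pow_zero, Matrix.one_mulVec, hf]
      split_ifs <;> norm_num
    | succ i ih =>
      intro x y
      rw [mul_add, mul_one, add_comm, pow_add, ← Matrix.mulVec_mulVec, pow_succ']
      exact abs_pow_mulVec_sub_le_of_le ε hδ ih x y
  refine (key j x y).trans ?_
  have h1 : 1 - δ ≤ Real.exp (-δ) := by linarith [Real.add_one_le_exp (-δ)]
  rw [div_le_iff₀ hδ0] at hj
  calc (1 - δ) ^ j ≤ Real.exp (-δ) ^ j := pow_le_pow_left₀ (by linarith) h1 j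
    _ = Real.exp (-(j * δ)) := by rw [← Real.exp_nat_mul]; ring_nf
    _ ≤ Real.exp (-2) := Real.exp_le_exp.2 (by linarith)
    _ ≤ 1 / 4 := by
      rw [Real.exp_neg, one_div]
      refine inv_anti₀ (by norm_num) ?_
      have h2 : Real.exp 2 = Real.exp 1 * Real.exp 1 := by rw [← Real.exp_add]; norm_num
      have := Real.add_one_le_exp (1:ℝ)
      rw [h2]
      nlinarith

end Doeblin

/-! ### The exponential upper bound for all semantics -/

section UniformBound

open VotingVar

theorem exp_neg_add_one_le_sigmoid {c : ℝ} (hc : 0 ≤ c) :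
    Real.exp (-(c + 1)) ≤ Real.sigmoid (-c) := by
  rw [Real.sigmoid_def, neg_neg, Real.exp_neg]
  refine inv_anti₀ (by positivity) ?_
  rw [Real.exp_add]
  have h1 := Real.add_one_le_exp (1:ℝ)
  have h2 := Real.one_le_exp hc
  nlinarith

/-- The quotient `N ^ N / N!` is one term of the series of `exp N`. -/
theorem exp_neg_le_factorial_div_pow (N : ℕ) (hN : 0 < N) :
    Real.exp (-N) ≤ (N.factorial : ℝ) * ((N : ℝ)⁻¹) ^ N := by
  have h := Real.pow_div_factorial_le_exp (N : ℝ) (Nat.cast_nonneg N) N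
  have hN' : (0:ℝ) < N := by exact_mod_cast hN
  have hf : (0:ℝ) < N.factorial := by exact_mod_cast N.factorial_pos
  rw [Real.exp_neg]
  calc (Real.exp N)⁻¹ ≤ ((N:ℝ) ^ N / N.factorial)⁻¹ := inv_anti₀ (by positivity) h
    _ = _ := by rw [inv_div, inv_pow, div_eq_mul_inv]

/-- For each of the three semantics the mixing times are at most exponential in `n`. -/
theorem exists_votingMixingTimes_le_exp (σ : VotingSemantics) {ω : ℝ} (hω : 0 < ω) {n : ℕ}
    (hn : 1 ≤ n) : ∀ τ ∈ votingMixingTimes σ ω n,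
      ∃ t : ℕ, τ ≤ t ∧ (t : ℝ) ≤ Real.exp ((12 + 6 * ω) * n) := by
  rintro τ ⟨w, wT, wF, hw, hwω, hT, hF, rfl⟩
  have h := WeightBound.of_mem hw hwω hT hF
  have hn' : (1:ℝ) ≤ n := by exact_mod_cast hn
  obtain ⟨p, hpdef⟩ : ∃ p : VotingVar n → ℝ, p = Sum.elim
    (fun _ => Real.exp (-(2 * ω * n + 1))) (fun _ => Real.exp (-(2 * ω + 1))) := ⟨_, rfl⟩
  have hp0 : ∀ v, 0 ≤ p v := by
    rintro (v | v) <;> simp only [hpdef, Sum.elim_inl, Sum.elim_inr] <;> positivity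
  have hp : ∀ I v s, p v ≤ conditionalProb (votingEnergy σ w wT wF) I v s := by
    intro I v s
    rcases VotingVar.cases_voter v with rfl | ⟨b, i, rfl⟩
    · have : p Q = Real.exp (-(2 * ω * n + 1)) := by simp [hpdef]
      rw [this]
      exact (exp_neg_add_one_le_sigmoid (by positivity)).trans
        (sigmoid_neg_le_conditionalProb _ I _ (h.abs_query_le σ I) s)
    · have : p (voter b i) = Real.exp (-(2 * ω + 1)) := by cases b <;> simp [hpdef, voter]
      rw [this]
      exact (exp_neg_add_one_le_sigmoid (by positivity)).trans
        (sigmoid_neg_le_conditionalProb _ I _ (h.abs_voter_le σ b i I) s)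
  set N := 2 * n + 1 with hN
  have hNr : (N : ℝ) = 2 * n + 1 := by rw [hN]; push_cast; ring
  -- The product of the `p v` contributes `N + 6 ω n` to the exponent, and `N! / N ^ N` another `N`.
  set δ := Real.exp (-(2 * N + 6 * ω * n)) with hδ
  have hprod : ∏ v, p v = Real.exp (-(N + 6 * ω * n)) := by
    rw [Fintype.prod_sum_type, hpdef]
    simp only [Sum.elim_inl, Sum.elim_inr, Finset.prod_const, Finset.card_univ,
      Fintype.card_unit, Fintype.card_sum, Fintype.card_fin, ← Real.exp_nat_mul, ← Real.exp_add]
    congr 1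
    rw [hNr]
    push_cast
    ring
  have hlow : ∀ x, δ ≤ (gibbsMatrix (votingEnergy σ w wT wF) ^ N) x (fun _ => true) := by
    intro x
    have h1 := le_gibbsMatrix_pow_card (votingEnergy σ w wT wF) p hp0 hp Finset.univ x
      (fun _ => true) (by simp)
    rw [Finset.card_univ, VotingVar.card, ← hN, hprod] at h1
    refine le_trans ?_ h1
    calc δ = Real.exp (-N) * Real.exp (-(N + 6 * ω * n)) := by
          rw [hδ, ← Real.exp_add]; congr 1; ring
      _ ≤ _ := mul_le_mul_of_nonneg_right (exp_neg_le_factorial_div_pow N (by omega))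
          (Real.exp_pos _).le
  have hδ0 : 0 < δ := Real.exp_pos _
  refine ⟨N * ⌈2 / δ⌉₊, gibbsMixingTime_le_of_le _ hδ0 hlow (Nat.le_ceil _), ?_⟩
  have hδinv : δ⁻¹ = Real.exp (2 * N + 6 * ω * n) := by rw [hδ, Real.exp_neg, inv_inv]
  have h1 := Nat.ceil_lt_add_one (by positivity : 0 ≤ 2 / δ)
  have h2 : 1 ≤ δ⁻¹ := by rw [hδinv]; exact Real.one_le_exp (by positivity)
  have h3 : ((⌈2 / δ⌉₊ : ℕ) : ℝ) ≤ 3 * δ⁻¹ := by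
    rw [div_eq_mul_inv] at h1 ⊢
    linarith
  have h4 : 3 * (N:ℝ) ≤ Real.exp (2 * N) := by
    have h5 : Real.exp (2 * N) = Real.exp N * Real.exp N := by rw [← Real.exp_add]; congr 1; ring
    have h6 := Real.add_one_le_exp (N : ℝ)
    rw [h5]
    nlinarith
  push_cast
  calc (N:ℝ) * (⌈2 / δ⌉₊ : ℕ) ≤ N * (3 * δ⁻¹) := mul_le_mul_of_nonneg_left h3 (by positivity)
    _ = 3 * N * δ⁻¹ := by ring
    _ ≤ Real.exp (2 * N) * Real.exp (2 * N + 6 * ω * n) := by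
        rw [hδinv]
        exact mul_le_mul_of_nonneg_right h4 (Real.exp_pos _).le
    _ ≤ _ := by
        rw [← Real.exp_add, Real.exp_le_exp, hNr]
        nlinarith

end UniformBound

/-! ### Uniform resampling on the hypercube -/

section Hypercube

variable {V : Type} [Fintype V] [DecidableEq V]

/-- The sum of the values of the variables, each value being encoded as `1` or `-1`. -/
def magnetization (x : V → Bool) : ℝ := ∑ v, queryValue (x v)

theorem magnetization_update (x : V → Bool) (v : V) (s : Bool) :
    magnetization (Function.update x v s) =
      magnetization x - queryValue (x v) + queryValue s := by
  unfold magnetization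
  rw [← Finset.add_sum_erase _ _ (Finset.mem_univ v),
    ← Finset.add_sum_erase (a := v) _ (fun v => queryValue (x v)) (Finset.mem_univ v)]
  have : ∀ u ∈ Finset.univ.erase v, queryValue (Function.update x v s u) = queryValue (x u) := by
    intro u hu
    rw [Function.update_of_ne (Finset.ne_of_mem_erase hu)]
  rw [Finset.sum_congr rfl this]
  simp only [Function.update_self]
  ring

theorem conditionalProb_zero (x : V → Bool) (v : V) (s : Bool) :
    conditionalProb (0 : (V → Bool) → ℝ) x v s = 1 / 2 := by
  simp [conditionalProb]

theorem gibbsMatrix_zero_mulVec_magnetization [Nonempty V] :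
    (gibbsMatrix (0 : (V → Bool) → ℝ)).mulVec magnetization =
      (1 - (Fintype.card V : ℝ)⁻¹) • (magnetization : (V → Bool) → ℝ) := by
  ext x
  have hN : (Fintype.card V : ℝ) ≠ 0 := by simp
  rw [gibbsMatrix_mulVec]
  simp only [conditionalProb_zero, magnetization_update, Fintype.sum_bool, Pi.smul_apply,
    smul_eq_mul]
  have e : ∀ v, 1 / 2 * (magnetization x - queryValue (x v) + queryValue true) +
      1 / 2 * (magnetization x - queryValue (x v) + queryValue false) =
      magnetization x - queryValue (x v) := by
    intro v; simp [queryValue]; ring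
  simp only [e, Finset.sum_sub_distrib, Finset.sum_const, Finset.card_univ, nsmul_eq_mul]
  rw [← magnetization]
  field_simp

/-- A fresh sign has mean 0 and square 1. The fixed point of the recursion is the number of
variables, the stationary variance. -/
theorem gibbsMatrix_zero_mulVec_magnetization_sq [Nonempty V] :
    (gibbsMatrix (0 : (V → Bool) → ℝ)).mulVec (fun x => magnetization x ^ 2) =
      fun x => (1 - 2 * (Fintype.card V : ℝ)⁻¹) * magnetization x ^ 2 + 2 := by
  ext x
  have hN : (Fintype.card V : ℝ) ≠ 0 := by simp
  rw [gibbsMatrix_mulVec]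
  simp only [conditionalProb_zero, magnetization_update, Fintype.sum_bool]
  have e : ∀ v, 1 / 2 * (magnetization x - queryValue (x v) + queryValue true) ^ 2 +
      1 / 2 * (magnetization x - queryValue (x v) + queryValue false) ^ 2 =
      (magnetization x ^ 2 + 2) - 2 * magnetization x * queryValue (x v) := by
    intro v
    cases x v <;> simp [queryValue] <;> ring
  simp only [e, Finset.sum_sub_distrib, Finset.sum_const, Finset.card_univ, nsmul_eq_mul,
    ← Finset.mul_sum]
  rw [← magnetization]
  field_simp
  ring

theorem gibbsMatrix_zero_pow_mulVec_magnetization [Nonempty V] (t : ℕ) :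
    (gibbsMatrix (0 : (V → Bool) → ℝ) ^ t).mulVec magnetization =
      (1 - (Fintype.card V : ℝ)⁻¹) ^ t • (magnetization : (V → Bool) → ℝ) := by
  induction t with
  | zero => simp
  | succ t ih =>
    rw [gibbsMatrix_pow_succ_mulVec, ih, Matrix.mulVec_smul,
      gibbsMatrix_zero_mulVec_magnetization, smul_smul, pow_succ]

theorem gibbsMatrix_zero_pow_mulVec_magnetization_sq [Nonempty V] (t : ℕ) :
    (gibbsMatrix (0 : (V → Bool) → ℝ) ^ t).mulVec (fun x => magnetization x ^ 2) =
      fun x => (1 - 2 * (Fintype.card V : ℝ)⁻¹) ^ t * (magnetization x ^ 2 - Fintype.card V) +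
        Fintype.card V := by
  have hN : (Fintype.card V : ℝ) ≠ 0 := by simp
  induction t with
  | zero => ext x; simp
  | succ t ih =>
    have e : (fun x : V → Bool => (1 - 2 * (Fintype.card V : ℝ)⁻¹) ^ t *
        (magnetization x ^ 2 - Fintype.card V) + Fintype.card V) =
        (1 - 2 * (Fintype.card V : ℝ)⁻¹) ^ t • (fun x => magnetization x ^ 2) +
        ((Fintype.card V : ℝ) - (1 - 2 * (Fintype.card V : ℝ)⁻¹) ^ t * Fintype.card V) •
          (1 : (V → Bool) → ℝ) := by
      ext x
      simp only [Pi.add_apply, Pi.smul_apply, smul_eq_mul, Pi.one_apply]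
      ring
    rw [gibbsMatrix_pow_succ_mulVec, ih, e, Matrix.mulVec_add, Matrix.mulVec_smul,
      Matrix.mulVec_smul, gibbsMatrix_mulVec_one, gibbsMatrix_zero_mulVec_magnetization_sq]
    ext x
    simp only [Pi.add_apply, Pi.smul_apply, smul_eq_mul, Pi.one_apply, pow_succ]
    field_simp
    ring

theorem sum_gibbsMeasure_magnetization_sq [Nonempty V] :
    ∑ x : V → Bool, gibbsMeasure 0 x * magnetization x ^ 2 = Fintype.card V := by
  have hN : (Fintype.card V : ℝ) ≠ 0 := by simp
  have h := sum_gibbsMeasure_mulVec (0 : (V → Bool) → ℝ) (fun x => magnetization x ^ 2)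
  rw [gibbsMatrix_zero_mulVec_magnetization_sq] at h
  simp only [mul_add, mul_left_comm _ (1 - 2 * (Fintype.card V : ℝ)⁻¹), Finset.sum_add_distrib,
    ← Finset.mul_sum, ← Finset.sum_mul, sum_gibbsMeasure] at h
  field_simp at h
  linarith

theorem sum_filter_le_of_sq {Ω : Type} [Fintype Ω] (μ g : Ω → ℝ) (hμ : ∀ x, 0 ≤ μ x) {c : ℝ}
    (hc : 0 < c) (A : Finset Ω) (hA : ∀ x ∈ A, c ^ 2 ≤ g x) (hg : ∀ x, 0 ≤ g x) :
    ∑ x ∈ A, μ x ≤ (∑ x, μ x * g x) / c ^ 2 := by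
  rw [le_div_iff₀ (by positivity), Finset.sum_mul]
  refine (Finset.sum_le_sum fun x hx => mul_le_mul_of_nonneg_left (hA x hx) (hμ x)).trans ?_
  exact Finset.sum_le_sum_of_subset_of_nonneg (Finset.subset_univ A) fun x _ _ =>
    mul_nonneg (hμ x) (hg x)

/-- Uniform resampling is not mixed as long as the expected magnetization is large in comparison
with its standard deviation. -/
theorem exists_not_mixed_zero [Nonempty V] {t : ℕ} (hV : 2 ≤ Fintype.card V)
    (ht : 32 ≤ (Fintype.card V : ℝ) * ((1 - (Fintype.card V : ℝ)⁻¹) ^ t) ^ 2) :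
    ∃ (x : V → Bool) (A : Finset (V → Bool)),
      1 / 4 < |(∑ y ∈ A, (gibbsMatrix (0 : (V → Bool) → ℝ) ^ t) x y) -
        ∑ y ∈ A, gibbsMeasure (0 : (V → Bool) → ℝ) y| := by
  have hN : (2:ℝ) ≤ Fintype.card V := by exact_mod_cast hV
  set N : ℝ := (Fintype.card V : ℝ) with hNdef
  have hNinv : N⁻¹ ≤ 1 / 2 := by rw [one_div]; exact inv_anti₀ (by norm_num) hN
  set β : ℝ := (1 - N⁻¹) ^ t with hβ
  have hβ0 : 0 < β := pow_pos (by linarith) t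
  have hN0 : 0 < N := by linarith
  have hone : magnetization (fun _ : V => true) = N := by
    simp [magnetization, queryValue, hNdef]
  set μ : (V → Bool) → ℝ := fun y => (gibbsMatrix (0 : (V → Bool) → ℝ) ^ t) (fun _ => true) y
    with hμ
  have hμ1 : ∑ y, μ y = 1 := sum_gibbsMatrix_pow _ _ _
  have hE1 : ∑ y, μ y * magnetization y = N * β := by
    have := congrFun (gibbsMatrix_zero_pow_mulVec_magnetization (V := V) t) (fun _ => true)
    simp only [Pi.smul_apply, smul_eq_mul, hone, Matrix.mulVec, dotProduct] at this
    rw [mul_comm N]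
    exact this
  have hE2 : ∑ y, μ y * magnetization y ^ 2 ≤ N + N ^ 2 * β ^ 2 := by
    have := congrFun (gibbsMatrix_zero_pow_mulVec_magnetization_sq (V := V) t) (fun _ => true)
    simp only [hone, Matrix.mulVec, dotProduct] at this
    rw [this]
    -- Since `1 - 2/N ≤ (1 - 1/N)²`, the second moment exceeds the squared mean by at most `N`.
    have h1 : (1 - 2 * N⁻¹) ^ t ≤ β ^ 2 := by
      rw [hβ, ← pow_mul, mul_comm t, pow_mul]
      refine pow_le_pow_left₀ (by linarith) ?_ t
      nlinarith [sq_nonneg N⁻¹]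
    have h2 : 0 ≤ (1 - 2 * N⁻¹) ^ t := pow_nonneg (by linarith) t
    nlinarith [mul_le_mul_of_nonneg_left h1 (sq_nonneg N), mul_nonneg h2 hN0.le]
  have hVar : ∑ y, μ y * (magnetization y - N * β) ^ 2 ≤ N := by
    have e : ∀ y, μ y * (magnetization y - N * β) ^ 2 = μ y * magnetization y ^ 2 -
        2 * (N * β) * (μ y * magnetization y) + (N * β) ^ 2 * μ y := fun y => by ring
    simp only [e, Finset.sum_add_distrib, Finset.sum_sub_distrib, ← Finset.mul_sum, hE1, hμ1]
    linarith
  -- The threshold lies halfway between the stationary mean 0 and the mean `N β` at time `t`. By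
  -- Chebyshev, `A` has stationary probability at most 1/8, and at least 7/8 at time `t`.
  set A : Finset (V → Bool) := Finset.univ.filter fun y => N * β / 2 ≤ magnetization y with hA
  have hc : 0 < N * β / 2 := by positivity
  have hsmall : N / (N * β / 2) ^ 2 ≤ 1 / 8 := by
    rw [div_le_div_iff₀ (by positivity) (by norm_num)]
    nlinarith
  have h1 : ∑ y ∈ A, gibbsMeasure (0 : (V → Bool) → ℝ) y ≤ 1 / 8 := by
    refine (sum_filter_le_of_sq _ (fun y => magnetization y ^ 2) (gibbsMeasure_nonneg _) hc A
      ?_ fun _ => sq_nonneg _).trans ?_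
    · intro y hy
      exact pow_le_pow_left₀ hc.le (Finset.mem_filter.1 hy).2 2
    · rw [sum_gibbsMeasure_magnetization_sq]; exact hsmall
  have h2 : ∑ y ∈ Aᶜ, μ y ≤ 1 / 8 := by
    refine (sum_filter_le_of_sq _ (fun y => (magnetization y - N * β) ^ 2)
      (fun y => gibbsMatrix_pow_nonneg _ _ _ _) hc Aᶜ ?_ fun _ => sq_nonneg _).trans ?_
    · intro y hy
      have : magnetization y < N * β / 2 := by
        by_contra hcon
        exact (Finset.mem_compl.1 hy) (Finset.mem_filter.2 ⟨Finset.mem_univ y, not_lt.1 hcon⟩)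
      nlinarith
    · exact (div_le_div_of_nonneg_right hVar (by positivity)).trans hsmall
  have h3 := Finset.sum_add_sum_compl A μ
  refine ⟨fun _ => true, A, ?_⟩
  refine lt_of_lt_of_le ?_ (le_abs_self _)
  change 1 / 4 < ∑ y ∈ A, μ y - _
  linarith

theorem continuous_gibbsMatrix_pow {ε : ℝ → (V → Bool) → ℝ} (hε : ∀ I, Continuous fun w => ε w I)
    (t : ℕ) (x y : V → Bool) : Continuous fun w => (gibbsMatrix (ε w) ^ t) x y := by
  induction t generalizing x y with
  | zero => simpa using continuous_const
  | succ t ih =>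
    simp only [pow_succ, Matrix.mul_apply]
    refine continuous_finsetSum _ fun z _ => (ih x z).mul ?_
    unfold gibbsMatrix conditionalProb
    refine continuous_finsetSum _ fun v _ => continuous_finsetSum _ fun s _ => ?_
    split_ifs
    · refine continuous_const.mul (Continuous.div (Real.continuous_exp.comp (hε _))
        (continuous_finsetSum _ fun s _ => Real.continuous_exp.comp (hε _)) fun w => ?_)
      exact (Finset.sum_pos (fun _ _ => Real.exp_pos _) Finset.univ_nonempty).ne'
    · exact continuous_const

theorem continuous_gibbsMeasure {ε : ℝ → (V → Bool) → ℝ} (hε : ∀ I, Continuous fun w => ε w I)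
    (x : V → Bool) : Continuous fun w => gibbsMeasure (ε w) x := by
  unfold gibbsMeasure
  refine Continuous.div (Real.continuous_exp.comp (hε _))
    (continuous_finsetSum _ fun s _ => Real.continuous_exp.comp (hε _)) fun w => ?_
  exact (Finset.sum_pos (fun _ _ => Real.exp_pos _) Finset.univ_nonempty).ne'

end Hypercube

/-! ### The lower bound `n log n` for all semantics -/

section VotingLowerBound

/-- The weight `w = 0` is not admissible, but the failure to mix is a strict inequality at each of
finitely many times, so by continuity it persists for small `w > 0`. -/
theorem exists_le_votingMixingTime (σ : VotingSemantics) {ω : ℝ} (hω : 0 < ω) {n T : ℕ}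
    (hn : 1 ≤ n) (hT : ∀ t < T,
      32 ≤ ((2 * n + 1 : ℕ) : ℝ) * ((1 - ((2 * n + 1 : ℕ) : ℝ)⁻¹) ^ t) ^ 2) :
    ∃ τ ∈ votingMixingTimes σ ω n, (T : ℕ∞) ≤ τ := by
  set ε : ℝ → VotingWorld n → ℝ := fun w => votingEnergy σ w 0 0 with hε
  have hε0 : ε 0 = 0 := by ext I; simp [hε, votingEnergy]
  have hcont : ∀ I, Continuous fun w => ε w I := by
    intro I
    simp only [hε, votingEnergy]
    fun_prop
  have hev : ∀ t ∈ Finset.range T, ∀ᶠ w in nhds (0:ℝ),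
      ∃ (x : VotingWorld n) (A : Finset (VotingWorld n)),
        1 / 4 < |(∑ y ∈ A, (gibbsMatrix (ε w) ^ t) x y) - ∑ y ∈ A, gibbsMeasure (ε w) y| := by
    intro t ht
    have h1 := hT t (Finset.mem_range.1 ht)
    rw [← VotingVar.card n] at h1
    obtain ⟨x, A, hxA⟩ := exists_not_mixed_zero (by rw [VotingVar.card]; omega) h1
    rw [← hε0] at hxA
    have hc : Continuous fun w =>
        |(∑ y ∈ A, (gibbsMatrix (ε w) ^ t) x y) - ∑ y ∈ A, gibbsMeasure (ε w) y| :=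
      ((continuous_finsetSum _ fun y _ => continuous_gibbsMatrix_pow hcont t x y).sub
        (continuous_finsetSum _ fun y _ => continuous_gibbsMeasure hcont y)).abs
    filter_upwards [hc.continuousAt.eventually (lt_mem_nhds hxA)] with w hw
    exact ⟨x, A, hw⟩
  have hev2 := (Filter.eventually_all_finset (Finset.range T)).2 hev
  have hev3 := (hev2.filter_mono nhdsWithin_le_nhds).and (Ioo_mem_nhdsGT hω)
  obtain ⟨w, hw, hw0, hwω⟩ := hev3.exists
  refine ⟨gibbsMixingTime (ε w), ⟨w, 0, 0, hw0, ⟨by linarith, hwω.le⟩, ?_, ?_, rfl⟩, ?_⟩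
  · intro i; simp [hω.le]
  · intro i; simp [hω.le]
  · refine le_gibbsMixingTime _ _ fun t ht => ?_
    by_contra hlt
    have hlt' : t < T := by exact_mod_cast not_le.1 hlt
    obtain ⟨x, A, hxA⟩ := hw t (Finset.mem_range.2 hlt')
    exact absurd (ht x A) (not_le.2 hxA)

theorem exp_neg_two_mul_le {x : ℝ} (hx0 : 0 ≤ x) (hx : x ≤ 1 / 2) :
    Real.exp (-(2 * x)) ≤ 1 - x := by
  rw [← Real.le_log_iff_exp_le (by linarith)]
  refine le_trans ?_ (Real.one_sub_inv_le_log_of_pos (by linarith))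
  have h : (1 - x)⁻¹ ≤ 1 + 2 * x := by
    rw [inv_le_iff_one_le_mul₀ (by linarith)]
    nlinarith
  linarith

/-- For each of the three semantics some mixing time is at least `n log n / 8`. -/
theorem eventually_exists_le_votingMixingTime (σ : VotingSemantics) {ω : ℝ} (hω : 0 < ω) :
    ∀ᶠ n : ℕ in atTop, ∃ τ ∈ votingMixingTimes σ ω n, ∃ T : ℕ, (T : ℕ∞) ≤ τ ∧
      1 / 8 * (n * Real.log n) ≤ T := by
  have hev := (tendsto_natCast_atTop_atTop (R := ℝ)).eventually_ge_atTop
  filter_upwards [hev 1024, eventually_ge_atTop 1] with n hn hn1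
  have hcast : ((2 * n + 1 : ℕ) : ℝ) = 2 * n + 1 := by push_cast; ring
  have hlogn : 0 ≤ Real.log n := Real.log_nonneg (by linarith)
  obtain ⟨τ, hτ, hT⟩ := exists_le_votingMixingTime σ hω (T := ⌈1 / 8 * (n * Real.log n)⌉₊) hn1 (by
    intro t ht
    rw [Nat.lt_ceil] at ht
    rw [hcast]
    set N : ℝ := 2 * n + 1 with hN
    have hNpos : 0 < N := by positivity
    have hlog : Real.log n ≤ Real.log N := Real.log_le_log (by linarith) (by linarith)
    have hexp := exp_neg_two_mul_le (x := N⁻¹) (by positivity) (by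
      rw [one_div]; exact inv_anti₀ (by norm_num) (by linarith))
    -- Thus `β ≥ N^(-1/4)` and `N β² ≥ √N`, which is at least 32 because `n ≥ 1024`.
    have h1 : Real.exp (-(Real.log N / 4)) ≤ (1 - N⁻¹) ^ t := by
      refine le_trans ?_ (pow_le_pow_left₀ (Real.exp_pos _).le hexp t)
      rw [← Real.exp_nat_mul, Real.exp_le_exp]
      have h2 : (t : ℝ) ≤ 1 / 8 * (N * Real.log N) := by
        have := mul_le_mul (by linarith : (n:ℝ) ≤ N) hlog hlogn hNpos.le
        linarith
      have h3 : (t : ℝ) * (2 * N⁻¹) ≤ 1 / 8 * (N * Real.log N) * (2 * N⁻¹) :=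
        mul_le_mul_of_nonneg_right h2 (by positivity)
      have h4 : 1 / 8 * (N * Real.log N) * (2 * N⁻¹) = Real.log N / 4 := by
        field_simp; ring
      linarith
    have h5 := pow_le_pow_left₀ (Real.exp_pos _).le h1 2
    have h6 : N * Real.exp (-(Real.log N / 4)) ^ 2 = Real.sqrt N := by
      rw [← Real.exp_nat_mul, Real.sqrt_eq_rpow, Real.rpow_def_of_pos hNpos]
      nth_rewrite 1 [← Real.exp_log hNpos]
      rw [← Real.exp_add]
      congr 1
      push_cast
      ring
    have h7 : 32 ≤ Real.sqrt N := by
      rw [Real.le_sqrt (by norm_num) hNpos.le]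
      linarith
    calc (32:ℝ) ≤ _ := h7
      _ = _ := h6.symm
      _ ≤ _ := mul_le_mul_of_nonneg_left h5 hNpos.le)
  exact ⟨τ, hτ, _, hT, Nat.le_ceil _⟩

end VotingLowerBound

/-! ### Bottlenecks and mixing -/

section Bottleneck

variable {V S : Type} [Fintype V] [DecidableEq V] [Fintype S] [DecidableEq S]

theorem gibbsMatrix_pow_mulVec_mono (ε : (V → S) → ℝ) (t : ℕ) {f g : (V → S) → ℝ}
    (h : ∀ x, f x ≤ g x) (x : V → S) :
    (gibbsMatrix ε ^ t).mulVec f x ≤ (gibbsMatrix ε ^ t).mulVec g x :=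
  Finset.sum_le_sum fun y _ => mul_le_mul_of_nonneg_left (h y) (gibbsMatrix_pow_nonneg ..)

/-- The stationary chain leaves the event `A` within `t` steps with at most `t` times the
probability with which it does so in one step. -/
theorem sum_gibbsMeasure_escape_le [Nonempty V] [Nonempty S] (ε : (V → S) → ℝ)
    (A : Finset (V → S)) {Φ : ℝ}
    (hΦ : ∑ x ∈ A, gibbsMeasure ε x *
      (gibbsMatrix ε).mulVec (fun y => if y ∈ Aᶜ then 1 else 0) x ≤ Φ) (t : ℕ) :
    ∑ x ∈ A, gibbsMeasure ε x *
      (gibbsMatrix ε ^ t).mulVec (fun y => if y ∈ Aᶜ then 1 else 0) x ≤ t * Φ := by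
  set g : (V → S) → ℝ := fun y => if y ∈ Aᶜ then 1 else 0 with hg
  set φ : (V → S) → ℝ := fun y => if y ∈ A then (gibbsMatrix ε).mulVec g y else 0 with hφ
  have hg0 : ∀ y, 0 ≤ g y := fun y => by simp only [hg]; split_ifs <;> norm_num
  have hPg0 : ∀ y, 0 ≤ (gibbsMatrix ε).mulVec g y := fun y =>
    Finset.sum_nonneg fun z _ => mul_nonneg (gibbsMatrix_nonneg ..) (hg0 z)
  have hPg1 : ∀ y, (gibbsMatrix ε).mulVec g y ≤ 1 := by
    intro y
    have h1 := gibbsMatrix_pow_mulVec_mono ε 1 (f := g) (g := 1) (fun y => by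
      simp only [hg, Pi.one_apply]; split_ifs <;> norm_num) y
    rw [pow_one, gibbsMatrix_mulVec_one] at h1
    exact h1
  have hφ0 : ∀ y, 0 ≤ φ y := fun y => by
    simp only [hφ]; split_ifs
    · exact hPg0 y
    · exact le_rfl
  -- A chain outside `A` after a step either escapes from `A` in that step (`φ`) or was already
  -- outside (`g`).
  have hle : ∀ y, (gibbsMatrix ε).mulVec g y ≤ (φ + g) y := by
    intro y
    by_cases hy : y ∈ A
    · simp [hφ, hg, hy]
    · simpa [hφ, hg, hy] using hPg1 y
  induction t with
  | zero =>
    simp only [pow_zero, Matrix.one_mulVec, Nat.cast_zero, zero_mul]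
    refine le_of_eq (Finset.sum_eq_zero fun x hx => ?_)
    simp [hg, hx]
  | succ t ih =>
    have hstep : ∀ x, (gibbsMatrix ε ^ (t + 1)).mulVec g x ≤
        (gibbsMatrix ε ^ t).mulVec φ x + (gibbsMatrix ε ^ t).mulVec g x := by
      intro x
      rw [pow_succ, ← Matrix.mulVec_mulVec, ← Pi.add_apply, ← Matrix.mulVec_add]
      exact gibbsMatrix_pow_mulVec_mono ε t hle x
    have hflow : ∑ x ∈ A, gibbsMeasure ε x * (gibbsMatrix ε ^ t).mulVec φ x ≤ Φ := by
      calc _ ≤ ∑ x, gibbsMeasure ε x * (gibbsMatrix ε ^ t).mulVec φ x :=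
            Finset.sum_le_sum_of_subset_of_nonneg (Finset.subset_univ A) fun x _ _ =>
              mul_nonneg (gibbsMeasure_nonneg ..)
                (Finset.sum_nonneg fun z _ => mul_nonneg (gibbsMatrix_pow_nonneg ..) (hφ0 z))
        _ = ∑ x, gibbsMeasure ε x * φ x := sum_gibbsMeasure_pow_mulVec ε φ t
        _ ≤ Φ := by
            refine le_trans (le_of_eq ?_) hΦ
            simp only [hφ, mul_ite, mul_zero]
            rw [Finset.sum_ite_mem, Finset.univ_inter]
    calc _ ≤ ∑ x ∈ A, (gibbsMeasure ε x * (gibbsMatrix ε ^ t).mulVec φ x +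
            gibbsMeasure ε x * (gibbsMatrix ε ^ t).mulVec g x) :=
          Finset.sum_le_sum fun x _ => by
            rw [← mul_add]
            exact mul_le_mul_of_nonneg_left (hstep x) (gibbsMeasure_nonneg ..)
      _ ≤ _ := by
          rw [Finset.sum_add_distrib]
          push_cast
          linarith

/-- A mixed chain is in `Aᶜ` with probability at least `1/2 - 1/4` from every start; starts in `A`
have mass `1/2`. -/
theorem le_mul_of_mixed [Nonempty V] [Nonempty S] (ε : (V → S) → ℝ)
    (A : Finset (V → S)) {Φ : ℝ}
    (hΦ : ∑ x ∈ A, gibbsMeasure ε x *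
      (gibbsMatrix ε).mulVec (fun y => if y ∈ Aᶜ then 1 else 0) x ≤ Φ)
    (hA : ∑ x ∈ A, gibbsMeasure ε x = 1 / 2) {t : ℕ}
    (ht : ∀ (x : V → S) (B : Finset (V → S)),
      |(∑ y ∈ B, (gibbsMatrix ε ^ t) x y) - ∑ y ∈ B, gibbsMeasure ε y| ≤ 1 / 4) :
    1 / 8 ≤ t * Φ := by
  refine le_trans ?_ (sum_gibbsMeasure_escape_le ε A hΦ t)
  have hAc : ∑ x ∈ Aᶜ, gibbsMeasure ε x = 1 / 2 := by
    have := Finset.sum_add_sum_compl A (gibbsMeasure ε)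
    rw [sum_gibbsMeasure, hA] at this
    linarith
  calc (1:ℝ) / 8 = ∑ x ∈ A, gibbsMeasure ε x * (1 / 4) := by
        rw [← Finset.sum_mul, hA]; norm_num
    _ ≤ _ := by
        refine Finset.sum_le_sum fun x _ =>
          mul_le_mul_of_nonneg_left ?_ (gibbsMeasure_nonneg ..)
        rw [mulVec_indicator]
        have := (abs_le.1 (ht x Aᶜ)).1
        linarith

end Bottleneck

/-! ### The exponential lower bound for linear semantics -/

section LinearLowerBound

open VotingVar

variable {n : ℕ}

theorem linearEnergy_eq (ω : ℝ) (I : VotingWorld n) :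
    votingEnergy .linear ω 0 0 I = ω * queryValue (I Q) *
      (∑ i, voterValue (I (T i)) - ∑ i, voterValue (I (F i))) := by
  simp [votingEnergy, VotingSemantics.strength]
  ring

theorem linearEnergy_update_Q (ω : ℝ) (I : VotingWorld n) :
    votingEnergy .linear ω 0 0 (Function.update I Q false) =
      -votingEnergy .linear ω 0 0 (Function.update I Q true) := by
  rw [linearEnergy_eq, linearEnergy_eq]
  simp [queryValue]

theorem linearEnergy_not (ω : ℝ) (I : VotingWorld n) :
    votingEnergy .linear ω 0 0 (fun v => !I v) = votingEnergy .linear ω 0 0 I := by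
  have hq : ∀ b, queryValue (!b) = -queryValue b := by intro b; cases b <;> simp [queryValue]
  have hv : ∀ b, voterValue (!b) = 1 - voterValue b := by intro b; cases b <;> simp [voterValue]
  rw [linearEnergy_eq, linearEnergy_eq]
  simp only [hq, hv, Finset.sum_sub_distrib]
  ring

/-- The event that the query variable is true. -/
def queryTrue (n : ℕ) : Finset (VotingWorld n) := Finset.univ.filter fun I => I Q = true

/-- Negating all variables exchanges the event with its complement and keeps the energy: the query
and the difference of the votes both change sign. -/
theorem sum_queryTrue_gibbsMeasure (ω : ℝ) :
    ∑ I ∈ queryTrue n, gibbsMeasure (votingEnergy .linear ω 0 0) I = 1 / 2 := by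
  have hinv : Function.Involutive fun (I : VotingWorld n) v => !I v := fun I => by simp
  have h1 : ∑ I ∈ queryTrue n, gibbsMeasure (votingEnergy .linear ω 0 0) I =
      ∑ I ∈ (queryTrue n)ᶜ, gibbsMeasure (votingEnergy .linear ω 0 0) I := by
    refine Finset.sum_equiv hinv.toPerm (fun I => ?_) (fun I _ => ?_)
    · simp [queryTrue]
    · simp [gibbsMeasure, linearEnergy_not]
  have h2 := Finset.sum_add_sum_compl (queryTrue n) (gibbsMeasure (votingEnergy .linear ω 0 0))
  rw [sum_gibbsMeasure] at h2
  linarith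

theorem le_partition_linear (ω : ℝ) :
    ((1 + Real.exp ω) * (1 + Real.exp (-ω))) ^ n ≤
      ∑ I : VotingWorld n, Real.exp (votingEnergy .linear ω 0 0 I) := by
  -- The factor 0 at a false query discards half of the worlds; on the rest the weight is a product
  -- over the voters.
  obtain ⟨f, hf⟩ : ∃ f : VotingVar n → Bool → ℝ, f = Sum.elim (fun _ b => if b then 1 else 0)
    (Sum.elim (fun _ b => Real.exp (ω * voterValue b)) fun _ b => Real.exp (-ω * voterValue b)) :=
    ⟨_, rfl⟩
  have h1 : ∏ v, ∑ b, f v b = ((1 + Real.exp ω) * (1 + Real.exp (-ω))) ^ n := by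
    rw [Fintype.prod_sum_type, Fintype.prod_sum_type, hf, mul_pow]
    simp [voterValue, add_comm]
  rw [← h1, Finset.prod_univ_sum, Fintype.piFinset_univ]
  refine Finset.sum_le_sum fun I _ => ?_
  rw [Fintype.prod_sum_type, Fintype.prod_sum_type, hf, linearEnergy_eq]
  simp only [Sum.elim_inl, Sum.elim_inr, Finset.univ_unique, Finset.prod_singleton,
    ← Real.exp_sum, ← Real.exp_add, ← Finset.mul_sum]
  cases hQ : I (Sum.inl default)
  · simp only [Bool.false_eq_true, if_false, zero_mul]
    positivity
  · simp only [if_true, one_mul, queryValue]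
    refine le_of_eq (congrArg Real.exp ?_)
    ring

/-- Only resampling the query leaves the event. Flipping it negates the energy, so `π(I)` times the
probability of the flip is at most `1 / Z` for each of at most `2 * 4 ^ n` worlds. -/
theorem queryTrue_flow_le (ω : ℝ) :
    ∑ I ∈ queryTrue n, gibbsMeasure (votingEnergy .linear ω 0 0) I *
      (gibbsMatrix (votingEnergy .linear ω 0 0)).mulVec
        (fun J => if J ∈ (queryTrue n)ᶜ then 1 else 0) I ≤
      2 * (4 / ((1 + Real.exp ω) * (1 + Real.exp (-ω)))) ^ n := by
  set ε : VotingWorld n → ℝ := votingEnergy .linear ω 0 0 with hε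
  set Z := ∑ J : VotingWorld n, Real.exp (ε J) with hZ
  have hr : 0 < (1 + Real.exp ω) * (1 + Real.exp (-ω)) := by positivity
  have hZr : ((1 + Real.exp ω) * (1 + Real.exp (-ω))) ^ n ≤ Z := le_partition_linear ω
  have hZ0 : 0 < Z := (pow_pos hr n).trans_le hZr
  have hterm : ∀ I ∈ queryTrue n, gibbsMeasure ε I *
      (gibbsMatrix ε).mulVec (fun J => if J ∈ (queryTrue n)ᶜ then 1 else 0) I ≤ 1 / Z := by
    intro I hI
    have hIQ : I Q = true := by simpa [queryTrue] using hI
    have hupd : Function.update I Q true = I := by rw [← hIQ, Function.update_eq_self]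
    have hP : (gibbsMatrix ε).mulVec (fun J => if J ∈ (queryTrue n)ᶜ then 1 else 0) I =
        ((2 * n + 1 : ℕ) : ℝ)⁻¹ * conditionalProb ε I Q false := by
      rw [gibbsMatrix_mulVec, VotingVar.card, VotingVar.sum_eq]
      simp [queryTrue, Function.update_of_ne (voter_ne_Q _ _).symm, hIQ]
    have hN : ((2 * n + 1 : ℕ) : ℝ)⁻¹ ≤ 1 :=
      inv_le_one_of_one_le₀ (by push_cast; linarith [(Nat.cast_nonneg n : (0:ℝ) ≤ n)])
    have h1 : ((2 * n + 1 : ℕ) : ℝ)⁻¹ * conditionalProb ε I Q false ≤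
        conditionalProb ε I Q false :=
      mul_le_of_le_one_left (conditionalProb_nonneg ..) hN
    rw [hP]
    refine (mul_le_mul_of_nonneg_left h1 (gibbsMeasure_nonneg ..)).trans ?_
    have h2 : ε (Function.update I Q false) = -ε I := by
      rw [hε, linearEnergy_update_Q, hupd]
    rw [conditionalProb, Fintype.sum_bool, hupd, h2, gibbsMeasure, ← hZ, div_mul_div_comm,
      ← Real.exp_add, add_neg_cancel, Real.exp_zero]
    refine one_div_le_one_div_of_le hZ0 (le_mul_of_one_le_right hZ0.le ?_)
    have h3 := Real.add_one_le_exp (ε I)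
    have h4 := Real.add_one_le_exp (-ε I)
    linarith
  calc _ ≤ ∑ I ∈ queryTrue n, 1 / Z := Finset.sum_le_sum hterm
    _ ≤ ∑ _I : VotingWorld n, 1 / Z :=
        Finset.sum_le_sum_of_subset_of_nonneg (Finset.subset_univ _) fun _ _ _ => by positivity
    _ = 2 * 4 ^ n / Z := by
        rw [Finset.sum_const, Finset.card_univ, Fintype.card_fun, Fintype.card_bool,
          VotingVar.card, nsmul_eq_mul, pow_succ, pow_mul]
        push_cast
        ring
    _ ≤ 2 * 4 ^ n / ((1 + Real.exp ω) * (1 + Real.exp (-ω))) ^ n :=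
        div_le_div_of_nonneg_left (by positivity) (pow_pos hr n) hZr
    _ = _ := by rw [div_pow]; ring

/-- Under linear semantics some mixing time is exponential in `n`. -/
theorem exists_exp_le_votingMixingTime_linear {ω : ℝ} (hω : 0 < ω) :
    ∃ r : ℝ, 1 < r ∧ ∀ n : ℕ, ∃ τ ∈ votingMixingTimes .linear ω n,
      ∃ T : ℕ, (T : ℕ∞) ≤ τ ∧ r ^ n / 16 ≤ T := by
  set r : ℝ := (1 + Real.exp ω) * (1 + Real.exp (-ω)) / 4 with hr
  -- Here `4 r = 2 + exp ω + exp (-ω)`, which exceeds 4 as `ω ≠ 0`.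
  have hr1 : 1 < r := by
    have h1 : 1 < Real.exp ω := Real.one_lt_exp_iff.2 hω
    have h2 : Real.exp ω * Real.exp (-ω) = 1 := by rw [← Real.exp_add]; simp
    have h3 := Real.exp_pos (-ω)
    rw [hr, lt_div_iff₀ (by norm_num)]
    have h4 : Real.exp (-ω) < 1 := by nlinarith
    nlinarith [mul_pos (sub_pos.2 h1) (sub_pos.2 h4)]
  refine ⟨r, hr1, fun n => ⟨gibbsMixingTime (votingEnergy .linear ω 0 0),
    ⟨ω, 0, 0, hω, ⟨by linarith, le_rfl⟩, ?_, ?_, rfl⟩, ⌈r ^ n / 16⌉₊, ?_, Nat.le_ceil _⟩⟩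
  · intro i; simp [hω.le]
  · intro i; simp [hω.le]
  · refine le_gibbsMixingTime _ _ fun t ht => ?_
    have h := le_mul_of_mixed _ _ (queryTrue_flow_le ω) (sum_queryTrue_gibbsMeasure ω) ht
    rw [Nat.cast_le, Nat.ceil_le]
    have h1 : 4 / ((1 + Real.exp ω) * (1 + Real.exp (-ω))) = r⁻¹ := by rw [hr, inv_div]
    rw [h1, inv_pow] at h
    have hrn : 0 < r ^ n := by positivity
    have h2 : (t : ℝ) * (2 * (r ^ n)⁻¹) = 2 * t / r ^ n := by ring
    rw [h2, le_div_iff₀ hrn] at h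
    linarith

end LinearLowerBound

/-! ### Existence of the largest mixing time and conclusion -/

theorem exists_isGreatest_natCast {S : Set ℕ∞} (hne : S.Nonempty) {B : ℝ}
    (hB : ∀ τ ∈ S, ∃ t : ℕ, τ ≤ t ∧ (t : ℝ) ≤ B) : ∃ k : ℕ, IsGreatest S (k : ℕ∞) := by
  have hnat : ∀ τ ∈ S, ∃ k : ℕ, τ = k := by
    intro τ hτ
    obtain ⟨t, ht, -⟩ := hB τ hτ
    exact ⟨τ.toNat, (ENat.natCast_toNat (ne_top_of_le_ne_top (ENat.natCast_ne_top t) ht)).symm⟩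
  have hbdd : BddAbove {k : ℕ | (k : ℕ∞) ∈ S} := by
    refine ⟨⌊B⌋₊, fun k hk => ?_⟩
    obtain ⟨t, ht, htB⟩ := hB _ hk
    exact (Nat.cast_le.1 ht).trans (Nat.le_floor htB)
  have hne' : {k : ℕ | (k : ℕ∞) ∈ S}.Nonempty := by
    obtain ⟨τ, hτ⟩ := hne
    obtain ⟨k, rfl⟩ := hnat τ hτ
    exact ⟨k, hτ⟩
  refine ⟨sSup {k : ℕ | (k : ℕ∞) ∈ S}, Nat.sSup_mem hne' hbdd, fun τ hτ => ?_⟩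
  obtain ⟨k, rfl⟩ := hnat τ hτ
  exact Nat.cast_le.2 (le_csSup hbdd hτ)

theorem votingMixingTimes_nonempty (σ : VotingSemantics) {ω : ℝ} (hω : 0 < ω) (n : ℕ) :
    (votingMixingTimes σ ω n).Nonempty :=
  ⟨_, ω, 0, 0, hω, ⟨by linarith, le_rfl⟩, fun i => by simp [hω.le], fun i => by simp [hω.le], rfl⟩

theorem isTheta_mul_log_of_isGreatest {σ : VotingSemantics} (hσ : σ ≠ .linear) {ω : ℝ}
    (hω : 0 < ω) {m : ℕ → ℕ}
    (hm : ∀ n, 1 ≤ n → IsGreatest (votingMixingTimes σ ω n) (m n : ℕ∞)) :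
    (fun n : ℕ => (m n : ℝ)) =Θ[atTop] (fun n : ℕ => (n : ℝ) * Real.log n) := by
  have hnorm : ∀ n : ℕ, 1 ≤ n → ‖(n : ℝ) * Real.log n‖ = n * Real.log n := fun n hn => by
    have : 0 ≤ Real.log n := Real.log_nonneg (by exact_mod_cast hn)
    rw [Real.norm_of_nonneg (by positivity)]
  refine ⟨Asymptotics.IsBigO.of_bound 13 ?_, Asymptotics.IsBigO.of_bound 8 ?_⟩
  · filter_upwards [exists_votingMixingTimes_le hσ hω, eventually_ge_atTop 1] with n hn hn1
    obtain ⟨t, ht, htn⟩ := hn _ (hm n hn1).1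
    rw [hnorm n hn1, Real.norm_natCast]
    exact le_trans (by exact_mod_cast ht) htn
  · filter_upwards [eventually_exists_le_votingMixingTime σ hω, eventually_ge_atTop 1]
      with n hn hn1
    obtain ⟨τ, hτ, T, hT, hTn⟩ := hn
    have h1 : (T : ℝ) ≤ m n := by exact_mod_cast hT.trans ((hm n hn1).2 hτ)
    rw [hnorm n hn1, Real.norm_natCast]
    linarith

theorem mainTheorem2 (ω : ℝ) (hω : 0 < ω) :
    ∃ tmax : VotingSemantics → ℕ → ℕ,
      (∀ (σ : VotingSemantics) (n : ℕ), 1 ≤ n →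
        IsGreatest (votingMixingTimes σ ω n) (tmax σ n : ℕ∞)) ∧
      (∃ a b : ℝ, 0 < a ∧ 0 < b ∧ ∀ᶠ n : ℕ in atTop,
        (2 : ℝ) ^ (a * n) ≤ (tmax .linear n : ℝ) ∧ (tmax .linear n : ℝ) ≤ (2 : ℝ) ^ (b * n)) ∧
      (fun n : ℕ => (tmax .logical n : ℝ)) =Θ[atTop] (fun n : ℕ => (n : ℝ) * Real.log n) ∧
      (fun n : ℕ => (tmax .ratio n : ℝ)) =Θ[atTop] (fun n : ℕ => (n : ℝ) * Real.log n) := by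
  have hex : ∀ (σ : VotingSemantics) (n : ℕ), ∃ k : ℕ, 1 ≤ n →
      IsGreatest (votingMixingTimes σ ω n) (k : ℕ∞) := by
    intro σ n
    by_cases hn : 1 ≤ n
    · obtain ⟨k, hk⟩ := exists_isGreatest_natCast (votingMixingTimes_nonempty σ hω n)
        (exists_votingMixingTimes_le_exp σ hω hn)
      exact ⟨k, fun _ => hk⟩
    · exact ⟨0, fun h => absurd h hn⟩
  choose tmax htmax using hex
  refine ⟨tmax, htmax, ?_, isTheta_mul_log_of_isGreatest (by simp) hω (htmax .logical),
    isTheta_mul_log_of_isGreatest (by simp) hω (htmax .ratio)⟩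
  obtain ⟨r, hr, hlow⟩ := exists_exp_le_votingMixingTime_linear hω
  have hlog2 : 0 < Real.log 2 := Real.log_pos (by norm_num)
  have hlogr : 0 < Real.log r := Real.log_pos hr
  -- Half of the exponent `log r` is given up to absorb the factor `1 / 16`.
  refine ⟨Real.log r / (2 * Real.log 2), (12 + 6 * ω) / Real.log 2, by positivity,
    by positivity, ?_⟩
  have hev : ∀ᶠ n : ℕ in atTop, 16 ≤ Real.exp (Real.log r / 2 * n) :=
    (Real.tendsto_exp_atTop.comp (tendsto_natCast_atTop_atTop.const_mul_atTop
      (by positivity : 0 < Real.log r / 2))).eventually_ge_atTop 16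
  filter_upwards [hev, eventually_ge_atTop 1] with n hn hn1
  rw [Real.rpow_def_of_pos (by norm_num), Real.rpow_def_of_pos (by norm_num)]
  constructor
  · obtain ⟨τ, hτ, T, hT, hTn⟩ := hlow n
    have h1 : (T : ℝ) ≤ tmax .linear n := by
      exact_mod_cast hT.trans ((htmax .linear n hn1).2 hτ)
    refine le_trans ?_ (hTn.trans h1)
    have h2 : r ^ n = Real.exp (Real.log r / 2 * n) * Real.exp (Real.log r / 2 * n) := by
      rw [← Real.exp_add, ← add_mul, add_halves, mul_comm, Real.exp_nat_mul,
        Real.exp_log (by linarith)]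
    have h3 : Real.log 2 * (Real.log r / (2 * Real.log 2) * n) = Real.log r / 2 * n := by
      field_simp
    rw [h2, h3, le_div_iff₀ (by norm_num)]
    exact mul_le_mul_of_nonneg_left hn (Real.exp_pos _).le
  · obtain ⟨t, ht, htn⟩ := exists_votingMixingTimes_le_exp .linear hω hn1 _
      (htmax .linear n hn1).1
    have h1 : (tmax .linear n : ℝ) ≤ t := by exact_mod_cast ht
    have h3 : Real.log 2 * ((12 + 6 * ω) / Real.log 2 * n) = (12 + 6 * ω) * n := by
      field_simp
    rw [h3]
    exact h1.trans htn
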